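/- Let $W$ be a finite reflection group acting on a Euclidean space $V$, with root system $\Phi$ (a $W$-invariant set of vectors containing exactly two opposite roots orthogonal to each reflecting hyperplane of $W$, and no other vector), simple roots $\Delta$, positive and negative roots $\Phi^+=\Phi\cap\mathrm{cone}(\Delta)$ and $\Phi^-=-\Phi^+$, simple reflections $S=\{s_\alpha : \alpha\in\Delta\}$ and length function $\ell$ with respect to $S$. Let $\le$ be the right weak order on $W$: $u\le v$ iff $\ell(u)+\ell(u^{-1}v)=\ell(v)$. For $I\subseteq S$ let $W_I=\langle I\rangle$, let $w_{\circ,I}$ be the longest element of $W_I$, let $\Phi_I=W_I(\{\alpha\in\Delta : s_\alpha\in I\})$ and $\Phi_I^+=\Phi_I\cap\Phi^+$, and let $W^I=\{w\in W : \ell(ws)>\ell(w)\text{ for all }s\in I\}$. A standard parabolic coset is written $xW_I$ with $I\subseteq S$ and $x\in W^I$. The facial weak order $\le$ on the set of all standard parabolic cosets is the reflexive transitive closure of the relations $$xW_I\lessdot xW_{I\cup\{s\}}\ \ (s\in S\setminus I,\ x\in W^{I\cup\{s\}}),\qquad xW_I\lessdot x\,w_{\circ,I}\,w_{\circ,I\setminus\{s\}}W_{I\setminus\{s\}}\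 \ (s\in I).$$ The root inversion set of a coset is $R(xW_I)=x(\Phi^-\cup\Phi_I^+)$. Let $\equiv$ be a lattice congruence of the weak order, and let $\equiv_{\mathrm f}$ be the facial congruence it induces on the standard parabolic cosets: $xW_I\equiv_{\mathrm f}yW_J$ iff $x\equiv y$ and $xw_{\circ,I}\equiv yw_{\circ,J}$. For a class $\Gamma$ of $\equiv_{\mathrm f}$ put $R(\Gamma)=\bigcap_{zW_K\in\Gamma}R(zW_K)$. In the quotient, $\Gamma\le\Gamma'$ means that some element of $\Gamma$ is below some element of $\Gamma'$ in the facial weak order. **Theorem.** Let $\Gamma=[xW_I,yW_J]$ and $\Gamma'=[x'W_{I'},y'W_{J'}]$ be two congruence classes of $\equiv_{\mathrm f}$, written as intervals of the facial weak order. The following assertions are equivalent: 1. $\Gamma\le\Gamma'$ in the quotient of the facial weak order by $\equiv_{\mathrm f}$; 2. $xW_I\le x'W_{I'}$; 3. $yW_J\le y'W_{J'}$; 4. $xW_I\le y'W_{J'}$; 5. $x\le y'$ and $xw_{\circ,I}\le y'w_{\circ,J'}$ in the weak order; 6. $R(\Gamma)\setminus R(\Gamma')\subseteq\Phi^-$ and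 $R(\Gamma')\setminus R(\Gamma)\subseteq\Phi^+$; 7. $R(\Gamma)\cap\Phi^+\subseteq R(\Gamma')\cap\Phi^+$ and $R(\Gamma)\cap\Phi^-\supseteq R(\Gamma')\cap\Phi^-$. -/

import Mathlib

noncomputable section

/-- The orthogonal reflection `s_v` of a Euclidean space that sends `v` to `-v` and fixes the
orthogonal complement of `v` pointwise (meaningful for `v ≠ 0`). -/
def vectorReflection {V : Type*} [NormedAddCommGroup V] [InnerProductSpace ℝ V] (v : V) :
    V ≃ₗᵢ[ℝ] V :=
  (ℝ ∙ v)ᗮ.reflection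

/-- A finite reflection group `W` acting on a Euclidean space `V`, together with a root system `Φ`
for `W` and a choice of simple roots `Δ` (equivalently, of a fundamental chamber). -/
structure ReflectionSystem (V : Type*) [NormedAddCommGroup V] [InnerProductSpace ℝ V] where
  /-- the group -/
  W : Subgroup (V ≃ₗᵢ[ℝ] V)
  finite_W : Finite W
  /-- `W` is generated by the reflections that it contains -/
  closure_reflections :
    Subgroup.closure {g : V ≃ₗᵢ[ℝ] V | g ∈ W ∧ ∃ v : V, v ≠ 0 ∧ g = vectorReflection v} = W
  /-- the roots -/
  Φ : Set V
  root_ne_zero : ∀ α ∈ Φ, α ≠ 0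
  /-- every root is orthogonal to a reflecting hyperplane of `W` -/
  reflection_mem : ∀ α ∈ Φ, vectorReflection α ∈ W
  /-- `Φ` is invariant under `W` -/
  map_root_mem : ∀ w ∈ W, ∀ α ∈ Φ, w α ∈ Φ
  /-- exactly two (opposite) roots are orthogonal to each reflecting hyperplane of `W` -/
  two_roots : ∀ v : V, v ≠ 0 → vectorReflection v ∈ W →
    ∃ α : V, Φ ∩ ((ℝ ∙ v : Submodule ℝ V) : Set V) = {α, -α}
  /-- the simple roots -/
  Δ : Set V
  simple_subset : Δ ⊆ Φ
  simple_linearIndependent : LinearIndependent ℝ (Subtype.val : Δ → V)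
  /-- every root is a nonnegative or a nonpositive linear combination of the simple roots -/
  root_mem_or_neg_mem : ∀ α ∈ Φ,
    α ∈ PointedCone.hull ℝ Δ ∨ -α ∈ PointedCone.hull ℝ Δ

namespace ReflectionSystem

variable {V : Type*} [NormedAddCommGroup V] [InnerProductSpace ℝ V] (R : ReflectionSystem V)

/-- The positive roots `Φ⁺ = Φ ∩ cone(Δ)`. -/
def posRoots : Set V := {α | α ∈ R.Φ ∧ α ∈ PointedCone.hull ℝ R.Δ}

/-- The negative roots `Φ⁻ = Φ ∩ cone(-Δ) = -Φ⁺`. -/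
def negRoots : Set V := {α | α ∈ R.Φ ∧ -α ∈ PointedCone.hull ℝ R.Δ}

/-- The set `S` of simple reflections `s_α`, `α ∈ Δ`. -/
def S : Set R.W := {s | ∃ α ∈ R.Δ, (s : V ≃ₗᵢ[ℝ] V) = vectorReflection α}

/-- The length of `w`: the smallest length of a word in `S` representing `w`. -/
def length (w : R.W) : ℕ :=
  sInf {n | ∃ l : List R.W, (∀ s ∈ l, s ∈ R.S) ∧ l.prod = w ∧ l.length = n}

/-- The right weak order on `W`: `u ≤ v` iff `u` is a prefix of `v`, that is
`ℓ(u) + ℓ(u⁻¹ v) = ℓ(v)`. -/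
instance weakOrder : LE R.W := ⟨fun u v => R.length u + R.length (u⁻¹ * v) = R.length v⟩

/-- The standard parabolic subgroup `W_I`. -/
def parabolic (I : Set R.W) : Subgroup R.W := Subgroup.closure I

theorem exists_longest (I : Set R.W) :
    ∃ w ∈ R.parabolic I, ∀ u ∈ R.parabolic I, R.length u ≤ R.length w := by
  have : Finite R.W := R.finite_W
  obtain ⟨w, hw, h⟩ := Set.exists_max_image (R.parabolic I : Set R.W) R.length
    (Set.toFinite _) ⟨1, (R.parabolic I).one_mem⟩
  exact ⟨w, hw, h⟩

/-- The longest element `w_{∘,I}` of `W_I`. -/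
def longest (I : Set R.W) : R.W := (R.exists_longest I).choose

/-- The set `W^I` of elements of `W` without right descents in `I`, which are the minimal length
representatives of the cosets of `W_I`. -/
def minReps (I : Set R.W) : Set R.W := {w | ∀ s ∈ I, R.length w < R.length (w * s)}

/-- The Coxeter complex: the standard parabolic cosets `x W_I`, each given by its type `I ⊆ S` and
its minimal length representative `x ∈ W^I`. -/
@[ext]
structure ParabolicCoset where
  /-- the minimal length representative `x` -/
  rep : R.W
  /-- the type `I` -/
  type : Set R.W
  type_subset : type ⊆ R.S
  rep_mem : rep ∈ R.minReps type

variable {R}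

/-- The maximal length representative `x w_{∘,I}` of the coset `x W_I`. -/
def ParabolicCoset.maxRep (c : R.ParabolicCoset) : R.W := c.rep * R.longest c.type

/-- The two types of covering relations of the facial weak order:
`x W_I ⋖ x W_{I ∪ {s}}` for `s ∈ S ∖ I` with `x ∈ W^{I ∪ {s}}`, and
`x W_I ⋖ x w_{∘,I} w_{∘,I ∖ {s}} W_{I ∖ {s}}` for `s ∈ I`. -/
inductive FacialCover : R.ParabolicCoset → R.ParabolicCoset → Prop
  | up (c d : R.ParabolicCoset) (s : R.W) (hs : s ∈ R.S) (hI : s ∉ c.type)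
      (htype : d.type = insert s c.type) (hrep : d.rep = c.rep) : FacialCover c d
  | down (c d : R.ParabolicCoset) (s : R.W) (hI : s ∈ c.type)
      (htype : d.type = c.type \ {s})
      (hrep : d.rep = c.rep * R.longest c.type * R.longest (c.type \ {s})) : FacialCover c d

/-- The facial weak order: the reflexive transitive closure of its covering relations. -/
instance facialWeakOrder : Preorder R.ParabolicCoset where
  le := Relation.ReflTransGen FacialCover
  le_refl _ := Relation.ReflTransGen.refl
  le_trans _ _ _ := Relation.ReflTransGen.trans

/-- A lattice congruence of the weak order (which is a lattice): an equivalence relation that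
respects meets and joins. -/
structure IsWeakOrderCongruence (r : Setoid R.W) : Prop where
  meet : ∀ {x x' y y' m m' : R.W}, r x x' → r y y' →
    IsGLB {x, y} m → IsGLB {x', y'} m' → r m m'
  join : ∀ {x x' y y' m m' : R.W}, r x x' → r y y' →
    IsLUB {x, y} m → IsLUB {x', y'} m' → r m m'

/-- The facial congruence induced by a congruence `≡` of the weak order: `x W_I` and `y W_J` are
equivalent iff `x ≡ y` and `x w_{∘,I} ≡ y w_{∘,J}`. -/
def facialCongruence (r : Setoid R.W) : Setoid R.ParabolicCoset where
  r c d := r c.rep d.rep ∧ r c.maxRep d.maxRep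
  iseqv :=
    ⟨fun _ => ⟨r.refl _, r.refl _⟩, fun h => ⟨r.symm h.1, r.symm h.2⟩,
      fun h k => ⟨r.trans h.1 k.1, r.trans h.2 k.2⟩⟩

/-- The order of the quotient of the facial weak order on congruence classes: `Γ ≤ Γ'` iff some
element of `Γ` is below some element of `Γ'`. -/
def QuotientLE (Γ Γ' : Set R.ParabolicCoset) : Prop := ∃ c ∈ Γ, ∃ c' ∈ Γ', c ≤ c'

variable (R) in
/-- The root system `Φ_I = W_I(Δ_I)` of `W_I`, where `Δ_I = {α_s | s ∈ I}`. -/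
def parabolicRoots (I : Set R.W) : Set V :=
  {β | ∃ w ∈ R.parabolic I, ∃ α ∈ R.Δ, (∃ s ∈ I, (s : V ≃ₗᵢ[ℝ] V) = vectorReflection α) ∧
    β = (w : V ≃ₗᵢ[ℝ] V) α}

/-- The root inversion set `R(x W_I) = x (Φ⁻ ∪ Φ_I⁺)` of a standard parabolic coset. -/
def ParabolicCoset.rootSet (c : R.ParabolicCoset) : Set V :=
  (c.rep : V ≃ₗᵢ[ℝ] V) '' (R.negRoots ∪ (R.parabolicRoots c.type ∩ R.posRoots))

/-- The root inversion set of a congruence class: the intersection of the root inversion sets of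
its elements. -/
def classRootSet (Γ : Set R.ParabolicCoset) : Set V := ⋂ c ∈ Γ, c.rootSet

end ReflectionSystem

end

/-! Everything is read off the two extreme representatives of a coset. The weak order is inclusion
of inversion sets (`weakOrder_iff`), and the facial weak order is the componentwise weak order on
pairs (minimal, maximal representative) (`facial_le_iff`). The hard half of the latter is that
whenever distinct cosets compare componentwise, some facial cover of the lower one still lies below
the upper one (`exists_step`, `exists_down_step`).

The congruence enters only through lattice theory. A coset is an interval `[x, m]` of the weak order
in which `x` is the meet of `m` and some of its lower covers, and every set of lower covers of `m`
occurs (`isLowerFacial`). Replacing `m` by the bottom `z` of its congruence class gives a congruent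
face `[z ⊓ x, z]` (`IsLowerFacial.inf_mem`), so the least coset of a facial class has the bottom of
a weak order class as its maximal representative. Hence if the bottom of one facial class lies below
a member of another class, it lies below the bottom of that class (`bot_le_of_le`); dually for tops.
This takes assertion 4 to 2 and 3; the way back is transitivity.

For root sets, the positive part of `R(c)` is the inversion set of the maximal representative, and
the negative part records the non-inversions of the minimal one. Intersecting over a class `[a, b]`,
the positive part is attained at `a` and the negative part at `b`. So assertion 7 compares the
maximal representatives of the bottoms and the minimal representatives of the tops: it follows from
2 and 3 and implies 5. -/

/-- In a finite poset where any two covers of a common element have a join, any two elements with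
a common lower bound have a join. -/
theorem exists_isLUB_of_covBy {P : Type*} [PartialOrder P] [Finite P]
    (h : ∀ z a b : P, z ⋖ a → z ⋖ b → ∃ j, IsLUB {a, b} j) (z x y : P) (hx : z ≤ x) (hy : z ≤ y) :
    ∃ j, IsLUB {x, y} j := by
  induction z using WellFoundedGT.induction generalizing x y with
  | ind z ih =>
    rcases hx.eq_or_lt with rfl | hx
    · exact ⟨y, by rintro t (rfl | rfl); exacts [hy, le_rfl], fun u hu => hu (by simp)⟩
    rcases hy.eq_or_lt with rfl | hy
    · exact ⟨x, by rintro t (rfl | rfl); exacts [le_rfl, hx.le], fun u hu => hu (by simp)⟩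
    obtain ⟨x₁, hzx, hx₁⟩ := exists_covBy_le_of_lt hx
    obtain ⟨y₁, hzy, hy₁⟩ := exists_covBy_le_of_lt hy
    -- The join is built as `(x ⊔ (x₁ ⊔ y₁)) ⊔ y`: the inner join with `x` exists by induction over
    -- `x₁`, the outer one by induction over `y₁`.
    obtain ⟨j, hj⟩ := h z x₁ y₁ hzx hzy
    obtain ⟨k, hk⟩ := ih x₁ hzx.lt x j hx₁ (hj.1 (by simp))
    have hjk : j ≤ k := hk.1 (by simp)
    obtain ⟨l, hl⟩ := ih y₁ hzy.lt k y ((hj.1 (by simp)).trans hjk) hy₁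
    have hkl : k ≤ l := hl.1 (by simp)
    refine ⟨l, ?_, fun u hu => hl.2 ?_⟩
    · rintro t (rfl | rfl)
      · exact (hk.1 (by simp)).trans hkl
      · exact hl.1 (by simp)
    · have hxu : x ≤ u := hu (by simp)
      have hyu : y ≤ u := hu (by simp)
      rintro t (rfl | rfl)
      · refine hk.2 ?_
        rintro t (rfl | rfl)
        · exact hxu
        · refine hj.2 ?_
          rintro t (rfl | rfl)
          · exact hx₁.trans hxu
          · exact hy₁.trans hyu
      · exact hyu

/-! ### Lattice congruences and faces of a lattice -/

section Congruence

variable {L : Type*} [Lattice L] (r : Setoid L)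

theorem Setoid.exists_min_of_inf [Finite L]
    (hinf : ∀ {x x' y y' : L}, r x x' → r y y' → r (x ⊓ y) (x' ⊓ y'))
    (m : L) : ∃ z, r z m ∧ ∀ y, r y m → z ≤ y := by
  obtain ⟨z, hz, hmin⟩ := (Set.toFinite {z | r z m}).exists_minimal ⟨m, r.refl m⟩
  refine ⟨z, hz, fun y hy => ?_⟩
  have h1 : r (z ⊓ y) m := by simpa using hinf hz hy
  exact (hmin h1 inf_le_left).trans inf_le_right

/-- A set of pairs `(x, m)` of elements of a lattice such that `x` is the meet of lower covers of
`m`, and such that every set of lower covers arises in this way. -/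
structure IsLowerFacial (F : Set (L × L)) : Prop where
  exists_covers : ∀ {x m}, (x, m) ∈ F → ∃ K : Set L, (∀ c ∈ K, c ⋖ m) ∧ IsGLB (insert m K) x
  exists_face : ∀ (z : L) (K : Set L), (∀ c ∈ K, c ⋖ z) →
    ∃ x, (x, z) ∈ F ∧ IsGLB (insert z K) x

variable {r} {F : Set (L × L)}

/-- A lower cover `c` of `m` is either above `z` or meets `z` in a lower cover of `z`, so the covers
defining `x` descend to covers of `z` with meet `z ⊓ x`. -/
theorem IsLowerFacial.inf_mem (hF : IsLowerFacial F)
    (hinf : ∀ {x x' y y' : L}, r x x' → r y y' → r (x ⊓ y) (x' ⊓ y'))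
    (hsup : ∀ {x x' y y' : L}, r x x' → r y y' → r (x ⊔ y) (x' ⊔ y'))
    {x m z : L} (hxm : (x, m) ∈ F) (hz : r z m) (hmin : ∀ y, r y m → z ≤ y) :
    (z ⊓ x, z) ∈ F := by
  obtain ⟨K, hK, hx⟩ := hF.exists_covers hxm
  have hzm : z ≤ m := hmin m (r.refl m)
  have hcov : ∀ c ∈ K, ¬ z ≤ c → z ⊓ c ⋖ z := by
    intro c hc hzc
    refine ⟨lt_of_le_of_ne inf_le_left fun h => hzc (inf_eq_left.1 h), fun t h1 h2 => ?_⟩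
    have h3 : c ≤ t ⊔ c := le_sup_right
    have h4 : t ⊔ c ≤ m := sup_le (h2.le.trans hzm) (hK c hc).le
    rcases (hK c hc).eq_or_eq h3 h4 with h5 | h5
    · exact absurd (le_inf h2.le (sup_eq_right.1 h5)) h1.not_ge
    -- With `z ⊓ c < t < z` this reads `t ≡ t ⊔ c = m`, against the minimality of `z`.
    · have h6 : r (t ⊔ (z ⊓ c)) (t ⊔ (m ⊓ c)) := hsup (r.refl t) (hinf hz (r.refl c))
      rw [sup_eq_left.2 h1.le, inf_eq_right.2 (hK c hc).le, h5] at h6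
      exact absurd (hmin t h6) h2.not_ge
  obtain ⟨x', hx'F, hx'⟩ := hF.exists_face z {t | ∃ c ∈ K, ¬ z ≤ c ∧ t = z ⊓ c} (by
    rintro t ⟨c, hc, hzc, rfl⟩
    exact hcov c hc hzc)
  have hG : IsGLB (insert z {t | ∃ c ∈ K, ¬ z ≤ c ∧ t = z ⊓ c}) (z ⊓ x) := by
    constructor
    · rintro t (rfl | ⟨c, hc, -, rfl⟩)
      · exact inf_le_left
      · exact inf_le_inf_left z (hx.1 (Set.mem_insert_of_mem _ hc))
    · intro y hy
      have hyz : y ≤ z := hy (Set.mem_insert _ _)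
      refine le_inf hyz (hx.2 ?_)
      rintro c (rfl | hc)
      · exact hyz.trans hzm
      · by_cases hzc : z ≤ c
        · exact hyz.trans hzc
        · exact (hy (Set.mem_insert_of_mem _ ⟨c, hc, hzc, rfl⟩)).trans inf_le_right
  rwa [hG.unique hx']

/-- If a lower cover `c` defining `x` were not above `x'`, then `c = c ⊔ x ≡ c ⊔ x' = z`, although
`z` is the bottom of its class. By symmetry, a face over such a `z` is determined by the class of
its bottom element. -/
theorem IsLowerFacial.le_of_rel (hF : IsLowerFacial F)
    (hsup : ∀ {x x' y y' : L}, r x x' → r y y' → r (x ⊔ y) (x' ⊔ y'))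
    {x x' z : L} (hmin : ∀ y, r y z → z ≤ y) (hx : (x, z) ∈ F) (hx' : (x', z) ∈ F)
    (hr : r x x') : x' ≤ x := by
  obtain ⟨K, hK, hG⟩ := hF.exists_covers hx
  obtain ⟨K', -, hG'⟩ := hF.exists_covers hx'
  have hx'z : x' ≤ z := hG'.1 (Set.mem_insert _ _)
  refine hG.2 ?_
  rintro c (rfl | hc)
  · exact hx'z
  · by_contra hno
    have h1 : c ⊔ x' = z :=
      ((hK c hc).eq_or_eq le_sup_left (sup_le (hK c hc).le hx'z)).resolve_left
        fun h => hno (sup_eq_left.1 h)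
    have h2 : r (c ⊔ x) (c ⊔ x') := hsup (r.refl c) hr
    rw [sup_eq_left.2 (hG.1 (Set.mem_insert_of_mem _ hc)), h1] at h2
    exact absurd (hmin c h2) (hK c hc).lt.not_ge

theorem IsLowerFacial.le_of_minimal [Finite L] (hF : IsLowerFacial F)
    (hinf : ∀ {x x' y y' : L}, r x x' → r y y' → r (x ⊓ y) (x' ⊓ y'))
    (hsup : ∀ {x x' y y' : L}, r x x' → r y y' → r (x ⊔ y) (x' ⊔ y'))
    {u v x m x' m' : L} (huv : (u, v) ∈ F)
    (hmin : ∀ p q, (p, q) ∈ F → r p u → r q v → u ≤ p ∧ v ≤ q)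
    (hxm : (x, m) ∈ F) (hxm' : (x', m') ∈ F) (hx : r x' x) (hm : r m' m)
    (hmin' : ∀ p q, (p, q) ∈ F → r p x' → r q m' → x' ≤ p ∧ m' ≤ q)
    (hux : u ≤ x) (hvm : v ≤ m) : u ≤ x' ∧ v ≤ m' := by
  have hle : ∀ {p q}, (p, q) ∈ F → p ≤ q := fun h =>
    let ⟨_, _, hG⟩ := hF.exists_covers h
    hG.1 (Set.mem_insert _ _)
  -- The upper end of a least face is the bottom of its class: otherwise the face pushed down by
  -- `inf_mem` would be congruent and smaller.
  have hfix : ∀ {p q}, (p, q) ∈ F →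
      (∀ s t, (s, t) ∈ F → r s p → r t q → p ≤ s ∧ q ≤ t) → ∀ y, r y q → q ≤ y := by
    intro p q hpq hpqm
    obtain ⟨z, hz, hzm⟩ := r.exists_min_of_inf hinf q
    have h1 : r (z ⊓ p) p := by
      have := hinf hz (r.refl p)
      rwa [inf_eq_right.2 (hle hpq)] at this
    have h2 := (hpqm _ _ (hF.inf_mem hinf hsup hpq hz hzm) h1 hz).2
    exact fun y hy => h2.trans (hzm y hy)
  have hv := hfix huv hmin
  have hm' := hfix hxm' hmin'
  have h1 : v ≤ m' := by
    have h2 : r (v ⊓ m') (v ⊓ m) := hinf (r.refl v) hm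
    rw [inf_eq_left.2 hvm] at h2
    exact (hv _ h2).trans inf_le_right
  refine ⟨?_, h1⟩
  -- Pushing `(x, m)` down to `m'` gives a face over `m'` congruent to `(x', m')`, so `m' ⊓ x ≤ x'`;
  -- and `u` is below both `m'` and `x`.
  have h3 : (m' ⊓ x, m') ∈ F :=
    hF.inf_mem hinf hsup hxm hm fun y hy => hm' y (r.trans hy (r.symm hm))
  have h4 : r x' (m' ⊓ x) := by
    have := hinf hm (r.refl x)
    rw [inf_eq_right.2 (hle hxm)] at this
    exact r.trans hx (r.symm this)
  exact (le_inf ((hle huv).trans h1) hux).trans (hF.le_of_rel hsup hm' hxm' h3 h4)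

end Congruence

/-! ### Reflections and roots -/

noncomputable section

namespace ReflectionSystem

open scoped InnerProductSpace

variable {V : Type*} [NormedAddCommGroup V] [InnerProductSpace ℝ V] (R : ReflectionSystem V)

/-- The linear action of the reflection group on the ambient space. -/
instance instAction : DistribMulAction R.W V where
  smul w x := (w : V ≃ₗᵢ[ℝ] V) x
  one_smul _ := rfl
  mul_smul _ _ _ := rfl
  smul_zero w := map_zero (w : V ≃ₗᵢ[ℝ] V)
  smul_add w := map_add (w : V ≃ₗᵢ[ℝ] V)

variable {R}

theorem smul_real (w : R.W) (c : ℝ) (x : V) : w • (c • x) = c • (w • x) :=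
  map_smul (w : V ≃ₗᵢ[ℝ] V) c x

theorem ext_smul {u v : R.W} (h : ∀ x : V, u • x = v • x) : u = v :=
  Subtype.ext (LinearIsometryEquiv.ext h)

theorem vectorReflection_apply (v x : V) :
    vectorReflection v x = x - (2 * (⟪v, x⟫_ℝ / ‖v‖ ^ 2)) • v := by
  rw [vectorReflection, Submodule.reflection_orthogonal_apply, Submodule.reflection_singleton_apply]
  simp only [neg_sub, two_smul, two_mul, add_smul]
  rfl

theorem vectorReflection_self (v : V) : vectorReflection v v = -v :=
  Submodule.reflection_orthogonalComplement_singleton_eq_neg v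

variable (R) in
/-- The reflection in a root, as an element of the group. -/
def rootReflection {β : V} (hβ : β ∈ R.Φ) : R.W := ⟨vectorReflection β, R.reflection_mem β hβ⟩

theorem rootReflection_smul {β : V} (hβ : β ∈ R.Φ) (x : V) :
    R.rootReflection hβ • x = x - (2 * (⟪β, x⟫_ℝ / ‖β‖ ^ 2)) • β :=
  vectorReflection_apply β x

theorem rootReflection_smul_self {β : V} (hβ : β ∈ R.Φ) : R.rootReflection hβ • β = -β :=
  vectorReflection_self β

theorem rootReflection_mul_self {β : V} (hβ : β ∈ R.Φ) :
    R.rootReflection hβ * R.rootReflection hβ = 1 :=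
  Subtype.ext (Submodule.reflection_mul_reflection _)

theorem rootReflection_inv {β : V} (hβ : β ∈ R.Φ) :
    (R.rootReflection hβ)⁻¹ = R.rootReflection hβ :=
  inv_eq_of_mul_eq_one_left (rootReflection_mul_self hβ)

theorem smul_mem_roots (w : R.W) {β : V} (hβ : β ∈ R.Φ) : w • β ∈ R.Φ :=
  R.map_root_mem w w.2 β hβ

theorem neg_mem_roots {β : V} (hβ : β ∈ R.Φ) : -β ∈ R.Φ := by
  rw [← rootReflection_smul_self hβ]
  exact smul_mem_roots _ hβ

theorem root_parallel {α β : V} (hα : α ∈ R.Φ) (hβ : β ∈ R.Φ) (c : ℝ) (h : β = c • α) :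
    β = α ∨ β = -α := by
  obtain ⟨γ, hγ⟩ := R.two_roots α (R.root_ne_zero α hα) (R.reflection_mem α hα)
  have h1 : α ∈ ({γ, -γ} : Set V) :=
    hγ ▸ ⟨hα, Submodule.mem_span_singleton_self α⟩
  have h2 : β ∈ ({γ, -γ} : Set V) :=
    hγ ▸ ⟨hβ, Submodule.mem_span_singleton.2 ⟨c, h.symm⟩⟩
  rcases h1 with rfl | h1 <;> rcases h2 with rfl | h2
  · exact Or.inl rfl
  · exact Or.inr h2
  · right; rw [show α = -β from h1, neg_neg]
  · left; rw [show α = -γ from h1, show β = -γ from h2]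

theorem eq_or_eq_neg_of_vectorReflection_eq {α β : V} (hα : α ∈ R.Φ) (hβ : β ∈ R.Φ)
    (h : vectorReflection α = vectorReflection β) : β = α ∨ β = -α := by
  have h1 := vectorReflection_apply α β
  rw [h, vectorReflection_self] at h1
  refine root_parallel hα hβ (⟪α, β⟫_ℝ / ‖α‖ ^ 2) ?_
  have h2 : (2 : ℝ) • β = (2 : ℝ) • ((⟪α, β⟫_ℝ / ‖α‖ ^ 2) • α) := by
    have h3 : (2 : ℝ) • β = β - -β := by rw [two_smul, sub_neg_eq_add]
    rw [h3, h1, smul_smul, sub_sub_cancel]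
  exact smul_right_injective V (two_ne_zero' ℝ) h2

variable (R) in
theorem finite_roots : R.Φ.Finite := by
  have : Finite R.W := R.finite_W
  refine Set.Finite.of_finite_fibers vectorReflection ?_ ?_
  · refine (Set.toFinite (R.W : Set (V ≃ₗᵢ[ℝ] V))).subset ?_
    rintro _ ⟨α, hα, rfl⟩
    exact R.reflection_mem α hα
  · rintro _ ⟨α, hα, rfl⟩
    refine (Set.toFinite {α, -α}).subset ?_
    rintro β ⟨hβ, h⟩
    exact eq_or_eq_neg_of_vectorReflection_eq hα hβ h.symm

variable (R) in
theorem finite_simple : R.Δ.Finite := R.finite_roots.subset R.simple_subset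

/-! ### Coordinates with respect to the simple roots -/

theorem exists_coord (α : V) : ∃ f : V →ₗ[ℝ] ℝ, ∀ β ∈ R.Δ, f β = Set.indicator {α} 1 β := by
  have h : LinearIndepOn ℝ id R.Δ := R.simple_linearIndependent
  refine ⟨(Module.Basis.extend h).constr ℝ (fun β => Set.indicator {α} 1 (β : V)), ?_⟩
  intro β hβ
  have h1 := (Module.Basis.extend h).constr_basis ℝ
    (fun β => Set.indicator {α} (1 : V → ℝ) (β : V)) ⟨β, h.subset_extend _ hβ⟩
  rwa [Module.Basis.extend_apply_self] at h1

variable (R) in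
/-- The coordinate at `α` of vectors in the span of the simple roots, extended linearly. -/
def coord (α : V) : V →ₗ[ℝ] ℝ := (R.exists_coord α).choose

theorem coord_self {α : V} (hα : α ∈ R.Δ) : R.coord α α = 1 := by
  rw [coord, (R.exists_coord α).choose_spec α hα]
  simp

theorem coord_of_ne {α β : V} (hβ : β ∈ R.Δ) (h : β ≠ α) : R.coord α β = 0 := by
  rw [coord, (R.exists_coord α).choose_spec β hβ]
  simp [h]

theorem coord_simple_nonneg (α : V) {β : V} (hβ : β ∈ R.Δ) : 0 ≤ R.coord α β := by
  by_cases h : β = α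
  · subst h; rw [coord_self hβ]; exact zero_le_one
  · rw [coord_of_ne hβ h]

theorem coord_nonneg (α : V) {p : V} (hp : p ∈ PointedCone.hull ℝ R.Δ) : 0 ≤ R.coord α p := by
  induction hp using Submodule.span_induction with
  | mem x hx => exact coord_simple_nonneg α hx
  | zero => simp
  | add x y _ _ hx hy => rw [map_add]; exact add_nonneg hx hy
  | smul c x _ hx =>
    rw [show c • x = (c : ℝ) • x from rfl, map_smul]
    exact mul_nonneg c.2 hx

theorem eq_sum_coord {p : V} (hp : p ∈ PointedCone.hull ℝ R.Δ) :
    p = ∑ α ∈ R.finite_simple.toFinset, R.coord α p • α := by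
  induction hp using Submodule.span_induction with
  | mem x hx =>
    rw [Finset.sum_eq_single_of_mem x (by simpa using hx)]
    · rw [coord_self hx, one_smul]
    · intro b _ hb
      rw [coord_of_ne hx hb.symm, zero_smul]
  | zero => simp
  | add x y _ _ hx hy =>
    simp only [map_add, add_smul, Finset.sum_add_distrib]
    rw [← hx, ← hy]
  | smul c x _ hx =>
    rw [show c • x = (c : ℝ) • x from rfl]
    simp only [map_smul, smul_assoc]
    rw [← Finset.smul_sum, ← hx]

theorem smul_mem_cone {D : Set V} {c : ℝ} (hc : 0 ≤ c) {p : V} (hp : p ∈ PointedCone.hull ℝ D) :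
    c • p ∈ PointedCone.hull ℝ D :=
  (PointedCone.hull ℝ D).smul_mem hc hp

theorem mem_cone_of_coord {p : V} (hp : p ∈ PointedCone.hull ℝ R.Δ) {D : Set V}
    (h : ∀ α ∈ R.Δ, α ∉ D → R.coord α p = 0) : p ∈ PointedCone.hull ℝ D := by
  rw [eq_sum_coord hp]
  refine Submodule.sum_mem _ fun α hα => ?_
  by_cases hD : α ∈ D
  · exact smul_mem_cone (coord_nonneg α hp) (Submodule.subset_span hD)
  · rw [h α (by simpa using hα) hD, zero_smul]
    exact Submodule.zero_mem _

theorem coord_eq_zero_of_mem_cone {D : Set V} (hD : D ⊆ R.Δ) {p : V}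
    (hp : p ∈ PointedCone.hull ℝ D) {α : V} (hα : α ∉ D) : R.coord α p = 0 := by
  induction hp using Submodule.span_induction with
  | mem x hx => exact coord_of_ne (hD hx) fun h => hα (h ▸ hx)
  | zero => simp
  | add x y _ _ hx hy => rw [map_add, hx, hy, add_zero]
  | smul c x _ hx => rw [show c • x = (c : ℝ) • x from rfl, map_smul, hx, smul_zero]

theorem smul_mem_cone_of_forall {D E : Set V} (w : R.W)
    (h : ∀ α ∈ D, w • α ∈ PointedCone.hull ℝ E) {p : V} (hp : p ∈ PointedCone.hull ℝ D) :
    w • p ∈ PointedCone.hull ℝ E := by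
  induction hp using Submodule.span_induction with
  | mem x hx => exact h x hx
  | zero => rw [smul_zero]; exact Submodule.zero_mem _
  | add x y _ _ hx hy => rw [smul_add]; exact Submodule.add_mem _ hx hy
  | smul c x _ hx =>
    rw [show c • x = (c : ℝ) • x from rfl, smul_real]
    exact smul_mem_cone c.2 hx

theorem neg_smul_mem_cone_of_forall {D E : Set V} (w : R.W)
    (h : ∀ α ∈ D, -(w • α) ∈ PointedCone.hull ℝ E) {p : V} (hp : p ∈ PointedCone.hull ℝ D) :
    -(w • p) ∈ PointedCone.hull ℝ E := by
  induction hp using Submodule.span_induction with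
  | mem x hx => exact h x hx
  | zero => rw [smul_zero, neg_zero]; exact Submodule.zero_mem _
  | add x y _ _ hx hy => rw [smul_add, neg_add]; exact Submodule.add_mem _ hx hy
  | smul c x _ hx =>
    rw [show c • x = (c : ℝ) • x from rfl, smul_real, ← smul_neg]
    exact smul_mem_cone c.2 hx

theorem eq_zero_of_mem_cone_of_neg_mem {p : V} (hp : p ∈ PointedCone.hull ℝ R.Δ)
    (hp' : -p ∈ PointedCone.hull ℝ R.Δ) : p = 0 := by
  rw [eq_sum_coord hp]
  refine Finset.sum_eq_zero fun α _ => ?_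
  have h1 := coord_nonneg α hp
  have h2 := coord_nonneg α hp'
  rw [map_neg] at h2
  rw [le_antisymm (by linarith) h1, zero_smul]

/-! ### Positive and negative roots -/

theorem simple_pos {α : V} (hα : α ∈ R.Δ) : α ∈ R.posRoots :=
  ⟨R.simple_subset hα, Submodule.subset_span hα⟩

theorem neg_mem_negRoots {β : V} : -β ∈ R.negRoots ↔ β ∈ R.posRoots := by
  constructor
  · rintro ⟨h1, h2⟩
    rw [neg_neg] at h2
    exact ⟨neg_neg β ▸ neg_mem_roots h1, h2⟩
  · rintro ⟨h1, h2⟩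
    exact ⟨neg_mem_roots h1, by rwa [neg_neg]⟩

theorem neg_mem_posRoots {β : V} : -β ∈ R.posRoots ↔ β ∈ R.negRoots := by
  rw [← neg_mem_negRoots, neg_neg]

theorem not_neg_of_pos {β : V} (h : β ∈ R.posRoots) : β ∉ R.negRoots := fun h' =>
  R.root_ne_zero β h.1 (eq_zero_of_mem_cone_of_neg_mem h.2 h'.2)

theorem pos_or_neg {β : V} (h : β ∈ R.Φ) : β ∈ R.posRoots ∨ β ∈ R.negRoots :=
  (R.root_mem_or_neg_mem β h).imp (fun h' => ⟨h, h'⟩) (fun h' => ⟨h, h'⟩)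

theorem not_pos_iff {β : V} (h : β ∈ R.Φ) : β ∉ R.posRoots ↔ β ∈ R.negRoots :=
  ⟨(pos_or_neg h).resolve_left, fun h1 h2 => not_neg_of_pos h2 h1⟩

theorem not_neg_iff {β : V} (h : β ∈ R.Φ) : β ∉ R.negRoots ↔ β ∈ R.posRoots :=
  ⟨(pos_or_neg h).resolve_right, not_neg_of_pos⟩

theorem mem_roots_of_smul {w : R.W} {β : V} (h : w • β ∈ R.Φ) : β ∈ R.Φ := by
  rw [← inv_smul_smul w β]
  exact smul_mem_roots _ h

variable (R) in
/-- The simple reflection of a simple root. -/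
def simpleReflection {α : V} (hα : α ∈ R.Δ) : R.W := R.rootReflection (R.simple_subset hα)

theorem simpleReflection_mul_self {α : V} (hα : α ∈ R.Δ) :
    R.simpleReflection hα * R.simpleReflection hα = 1 := rootReflection_mul_self _

theorem simpleReflection_inv {α : V} (hα : α ∈ R.Δ) :
    (R.simpleReflection hα)⁻¹ = R.simpleReflection hα := rootReflection_inv _

theorem simpleReflection_smul_self {α : V} (hα : α ∈ R.Δ) :
    R.simpleReflection hα • α = -α := rootReflection_smul_self _

theorem simpleReflection_mem {α : V} (hα : α ∈ R.Δ) : R.simpleReflection hα ∈ R.S :=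
  ⟨α, hα, rfl⟩

theorem exists_eq_simpleReflection {s : R.W} (hs : s ∈ R.S) :
    ∃ (α : V) (hα : α ∈ R.Δ), s = R.simpleReflection hα := by
  obtain ⟨α, hα, h⟩ := hs
  exact ⟨α, hα, Subtype.ext h⟩

/-- A simple reflection changes only the coordinate at `α`. A positive root other than `α` has a
positive coordinate elsewhere, which survives and rules out a negative image. -/
theorem simpleReflection_smul_pos {α : V} (hα : α ∈ R.Δ) {β : V} (hβ : β ∈ R.posRoots)
    (hne : β ≠ α) : R.simpleReflection hα • β ∈ R.posRoots := by
  by_contra hneg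
  rw [not_pos_iff (smul_mem_roots _ hβ.1)] at hneg
  by_cases h : ∀ γ ∈ R.Δ, γ ≠ α → R.coord γ β = 0
  · have h1 : β = R.coord α β • α := by
      conv_lhs => rw [eq_sum_coord hβ.2]
      rw [Finset.sum_eq_single_of_mem α (by simpa using hα)]
      intro b hb hb'
      rw [h b (by simpa using hb) hb', zero_smul]
    rcases root_parallel (R.simple_subset hα) hβ.1 _ h1 with h2 | h2
    · exact hne h2
    · subst h2
      exact not_neg_of_pos hβ (neg_mem_negRoots.2 (simple_pos hα))
  · push Not at h
    obtain ⟨γ, hγ, hγα, h0⟩ := h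
    have h1 := coord_nonneg γ hβ.2
    have h2 := coord_nonneg γ hneg.2
    rw [simpleReflection, rootReflection_smul, map_neg, map_sub, map_smul,
      coord_of_ne hα hγα.symm, smul_zero, sub_zero] at h2
    exact h0 (le_antisymm (by linarith) h1)

theorem simpleReflection_smul_neg_iff {α : V} (hα : α ∈ R.Δ) {β : V} (hβ : β ∈ R.Φ) :
    R.simpleReflection hα • β ∈ R.negRoots ↔ β = α ∨ (β ∈ R.negRoots ∧ β ≠ -α) := by
  constructor
  · intro h
    rcases pos_or_neg hβ with hp | hn
    · left
      by_contra hne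
      exact not_neg_of_pos (simpleReflection_smul_pos hα hp hne) h
    · right
      refine ⟨hn, ?_⟩
      rintro rfl
      rw [smul_neg, simpleReflection_smul_self, neg_neg] at h
      exact not_neg_of_pos (simple_pos hα) h
  · rintro (rfl | ⟨hn, hne⟩)
    · rw [simpleReflection_smul_self]
      exact neg_mem_negRoots.2 (simple_pos hα)
    · rw [← neg_mem_posRoots, ← smul_neg]
      exact simpleReflection_smul_pos hα (neg_mem_posRoots.2 hn) fun h => hne (by rw [← h, neg_neg])

/-! ### Inversion sets -/

variable (R) in
/-- The inversion set of `w`: the positive roots that `w⁻¹` makes negative. -/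
def inversions (w : R.W) : Set V := {β | β ∈ R.posRoots ∧ w⁻¹ • β ∈ R.negRoots}

theorem finite_inversions (w : R.W) : (R.inversions w).Finite :=
  R.finite_roots.subset fun _ h => h.1.1

theorem inversions_mul_of_pos {w : R.W} {α : V} (hα : α ∈ R.Δ) (h : w • α ∈ R.posRoots) :
    R.inversions (w * R.simpleReflection hα) = insert (w • α) (R.inversions w) := by
  ext β
  simp only [inversions, Set.mem_ofPred_eq, Set.mem_insert_iff, mul_inv_rev, mul_smul,
    simpleReflection_inv]
  constructor
  · rintro ⟨h1, h2⟩
    rcases (simpleReflection_smul_neg_iff hα (smul_mem_roots _ h1.1)).1 h2 with h3 | h3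
    · exact Or.inl (inv_smul_eq_iff.1 h3)
    · exact Or.inr ⟨h1, h3.1⟩
  · rintro (rfl | ⟨h1, h2⟩)
    · refine ⟨h, ?_⟩
      rw [inv_smul_smul, simpleReflection_smul_self]
      exact neg_mem_negRoots.2 (simple_pos hα)
    · refine ⟨h1, (simpleReflection_smul_neg_iff hα h2.1).2 (Or.inr ⟨h2, fun h3 => ?_⟩)⟩
      rw [inv_smul_eq_iff, smul_neg] at h3
      subst h3
      exact not_neg_of_pos h1 (neg_mem_negRoots.2 h)

theorem inversions_mul_of_neg {w : R.W} {α : V} (hα : α ∈ R.Δ) (h : w • α ∈ R.negRoots) :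
    R.inversions (w * R.simpleReflection hα) = R.inversions w \ {-(w • α)} := by
  ext β
  simp only [inversions, Set.mem_ofPred_eq, Set.mem_sdiff, Set.mem_singleton_iff, mul_inv_rev,
    mul_smul, simpleReflection_inv]
  constructor
  · rintro ⟨h1, h2⟩
    rcases (simpleReflection_smul_neg_iff hα (smul_mem_roots _ h1.1)).1 h2 with h3 | h3
    · rw [inv_smul_eq_iff] at h3
      subst h3
      exact absurd h (not_neg_of_pos h1)
    · refine ⟨⟨h1, h3.1⟩, fun h4 => h3.2 ?_⟩
      rw [h4, smul_neg, inv_smul_smul]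
  · rintro ⟨⟨h1, h2⟩, h3⟩
    refine ⟨h1, (simpleReflection_smul_neg_iff hα h2.1).2 (Or.inr ⟨h2, fun h4 => h3 ?_⟩)⟩
    rw [inv_smul_eq_iff, smul_neg] at h4
    exact h4

theorem smul_notMem_inversions {w : R.W} {α : V} (hα : α ∈ R.Δ) : w • α ∉ R.inversions w := by
  rintro ⟨_, h⟩
  rw [inv_smul_smul] at h
  exact not_neg_of_pos (simple_pos hα) h

theorem neg_smul_mem_inversions {w : R.W} {α : V} (hα : α ∈ R.Δ) (h : w • α ∈ R.negRoots) :
    -(w • α) ∈ R.inversions w := by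
  refine ⟨neg_mem_posRoots.2 h, ?_⟩
  rw [smul_neg, inv_smul_smul]
  exact neg_mem_negRoots.2 (simple_pos hα)

/-! ### Generation by the simple reflections -/

theorem smul_rootReflection (w : R.W) {β : V} (hβ : β ∈ R.Φ) :
    R.rootReflection (smul_mem_roots w hβ) = w * R.rootReflection hβ * w⁻¹ := by
  refine ext_smul fun x => ?_
  rw [mul_smul, mul_smul, rootReflection_smul, rootReflection_smul, smul_sub, smul_inv_smul,
    smul_real]
  have h1 : ⟪w • β, x⟫_ℝ = ⟪β, w⁻¹ • x⟫_ℝ := by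
    conv_lhs => rw [← smul_inv_smul w x]
    exact (w : V ≃ₗᵢ[ℝ] V).inner_map_map _ _
  have h2 : ‖w • β‖ = ‖β‖ := (w : V ≃ₗᵢ[ℝ] V).norm_map β
  rw [h1, h2]

/-- Take a counterexample of least height. Being a nonnegative combination of simple roots with
positive norm, it has positive inner product with some simple root; reflecting in that one lowers
the height, and the two reflections are conjugate. -/
theorem rootReflection_mem_closure {β : V} (hβ : β ∈ R.posRoots) :
    R.rootReflection hβ.1 ∈ Subgroup.closure R.S := by
  by_contra hcon
  let height : V → ℝ := fun p => ∑ α ∈ R.finite_simple.toFinset, R.coord α p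
  obtain ⟨γ, ⟨hγ, hγc⟩, hmin⟩ := Set.exists_min_image
    {γ | ∃ h : γ ∈ R.posRoots, R.rootReflection h.1 ∉ Subgroup.closure R.S} height
    (R.finite_roots.subset fun _ h => h.1.1) ⟨β, hβ, hcon⟩
  obtain ⟨α, hα, hpos⟩ : ∃ α ∈ R.Δ, 0 < ⟪α, γ⟫_ℝ := by
    by_contra hno
    push Not at hno
    have h1 : 0 < ⟪γ, γ⟫_ℝ := real_inner_self_pos.2 (R.root_ne_zero γ hγ.1)
    conv at h1 => rhs; arg 2; rw [eq_sum_coord hγ.2]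
    rw [sum_inner] at h1
    refine absurd h1 (not_lt.2 (Finset.sum_nonpos fun α hα => ?_))
    rw [real_inner_smul_left]
    exact mul_nonpos_of_nonneg_of_nonpos (coord_nonneg α hγ.2) (hno α (by simpa using hα))
  have hγα : γ ≠ α := by
    rintro rfl
    exact hγc (Subgroup.subset_closure (simpleReflection_mem hα))
  have hγ' := simpleReflection_smul_pos hα hγ hγα
  have hlt : height (R.simpleReflection hα • γ) < height γ := by
    refine Finset.sum_lt_sum (fun δ _ => ?_) ⟨α, by simpa using hα, ?_⟩
    · rw [simpleReflection, rootReflection_smul, map_sub, map_smul, smul_eq_mul]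
      have : 0 ≤ 2 * (⟪α, γ⟫_ℝ / ‖α‖ ^ 2) * R.coord δ α :=
        mul_nonneg (by positivity) (coord_simple_nonneg δ hα)
      linarith
    · rw [simpleReflection, rootReflection_smul, map_sub, map_smul, coord_self hα, smul_eq_mul]
      have : 0 < ‖α‖ := norm_pos_iff.2 (R.root_ne_zero α (R.simple_subset hα))
      have : 0 < 2 * (⟪α, γ⟫_ℝ / ‖α‖ ^ 2) * 1 := by positivity
      linarith
  have hmem : R.rootReflection hγ'.1 ∈ Subgroup.closure R.S := by
    by_contra h
    exact absurd (hmin _ ⟨hγ', h⟩) (not_le.2 hlt)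
  have hs : R.simpleReflection hα ∈ Subgroup.closure R.S :=
    Subgroup.subset_closure (simpleReflection_mem hα)
  rw [smul_rootReflection _ hγ.1] at hmem
  refine hγc ?_
  have := Subgroup.mul_mem _ (Subgroup.mul_mem _ (Subgroup.inv_mem _ hs) hmem) hs
  simpa [mul_assoc] using this

theorem vectorReflection_smul {c : ℝ} (hc : c ≠ 0) (v : V) :
    vectorReflection (c • v) = vectorReflection v := by
  unfold vectorReflection
  simp only [Submodule.span_singleton_smul_eq (IsUnit.mk0 c hc)]

variable (R) in
theorem closure_simple : Subgroup.closure R.S = ⊤ := by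
  rw [eq_top_iff]
  have key : R.W ≤ (Subgroup.closure R.S).map R.W.subtype := by
    conv_lhs => rw [← R.closure_reflections]
    rw [Subgroup.closure_le]
    rintro g ⟨hg, v, hv, rfl⟩
    obtain ⟨γ, hγ⟩ := R.two_roots v hv hg
    have hmem : γ ∈ R.Φ ∩ ((ℝ ∙ v : Submodule ℝ V) : Set V) := hγ ▸ Set.mem_insert γ _
    obtain ⟨c, hc⟩ := Submodule.mem_span_singleton.1 hmem.2
    have hc0 : c ≠ 0 := by
      rintro rfl
      exact R.root_ne_zero γ hmem.1 (by rw [← hc, zero_smul])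
    rw [← vectorReflection_smul hc0 v, hc]
    rcases pos_or_neg hmem.1 with hp | hn
    · exact ⟨_, rootReflection_mem_closure hp, rfl⟩
    · refine ⟨_, rootReflection_mem_closure (neg_mem_posRoots.2 hn), ?_⟩
      change vectorReflection (-γ) = _
      rw [← neg_one_smul ℝ γ, vectorReflection_smul (by norm_num)]
  rintro ⟨g, hg⟩ -
  obtain ⟨h, hh, rfl⟩ := key hg
  exact hh

theorem inv_mem_simple {s : R.W} (hs : s ∈ R.S) : s⁻¹ = s := by
  obtain ⟨α, hα, rfl⟩ := exists_eq_simpleReflection hs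
  exact simpleReflection_inv hα

theorem exists_word (w : R.W) : ∃ l : List R.W, (∀ s ∈ l, s ∈ R.S) ∧ l.prod = w := by
  have hw : w ∈ Subgroup.closure R.S := R.closure_simple ▸ Subgroup.mem_top w
  induction hw using Subgroup.closure_induction with
  | mem s hs => exact ⟨[s], by simpa using hs, by simp⟩
  | one => exact ⟨[], by simp, rfl⟩
  | mul u v _ _ hu hv =>
    obtain ⟨l, hl, rfl⟩ := hu
    obtain ⟨l', hl', rfl⟩ := hv
    exact ⟨l ++ l', fun s hs => (List.mem_append.1 hs).elim (hl s) (hl' s), List.prod_append⟩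
  | inv u _ hu =>
    obtain ⟨l, hl, rfl⟩ := hu
    refine ⟨(l.map fun s => s⁻¹).reverse, fun s hs => ?_, (List.prod_inv_reverse l).symm⟩
    rw [List.mem_reverse, List.mem_map] at hs
    obtain ⟨t, ht, rfl⟩ := hs
    rw [inv_mem_simple (hl t ht)]
    exact hl t ht

/-! ### The length function -/

theorem length_prod_le {l : List R.W} (hl : ∀ s ∈ l, s ∈ R.S) : R.length l.prod ≤ l.length :=
  Nat.sInf_le ⟨l, hl, rfl, rfl⟩

theorem exists_reduced_word (w : R.W) :
    ∃ l : List R.W, (∀ s ∈ l, s ∈ R.S) ∧ l.prod = w ∧ l.length = R.length w := by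
  obtain ⟨l, hl, hw⟩ := exists_word w
  exact Nat.sInf_mem (s := {n | ∃ l : List R.W, (∀ s ∈ l, s ∈ R.S) ∧ l.prod = w ∧ l.length = n})
    ⟨l.length, l, hl, hw, rfl⟩

theorem length_mul_le (w : R.W) {s : R.W} (hs : s ∈ R.S) :
    R.length (w * s) ≤ R.length w + 1 := by
  obtain ⟨l, hl, rfl, hlen⟩ := exists_reduced_word w
  rw [← hlen]
  have : ∀ t ∈ l ++ [s], t ∈ R.S := by
    intro t ht
    rcases List.mem_append.1 ht with h | h
    · exact hl t h
    · rwa [List.mem_singleton.1 h]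
  simpa using length_prod_le this

/-- The exchange condition. -/
theorem exists_exchange (l : List R.W) (hl : ∀ s ∈ l, s ∈ R.S) {α : V} (hα : α ∈ R.Δ)
    (h : l.prod • α ∈ R.negRoots) :
    ∃ l' : List R.W, (∀ s ∈ l', s ∈ R.S) ∧ l'.prod = l.prod * R.simpleReflection hα ∧
      l'.length + 1 = l.length := by
  induction l with
  | nil =>
    rw [List.prod_nil, one_smul] at h
    exact absurd h (not_neg_of_pos (simple_pos hα))
  | cons s t ih =>
    rw [List.forall_mem_cons] at hl
    by_cases ht : t.prod • α ∈ R.negRoots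
    · obtain ⟨t', h1, h2, h3⟩ := ih hl.2 ht
      refine ⟨s :: t', List.forall_mem_cons.2 ⟨hl.1, h1⟩, ?_, ?_⟩
      · rw [List.prod_cons, List.prod_cons, h2, mul_assoc]
      · rw [List.length_cons, List.length_cons, h3]
    · refine ⟨t, hl.2, ?_, rfl⟩
      obtain ⟨γ, hγ, rfl⟩ := exists_eq_simpleReflection hl.1
      have hΦ := smul_mem_roots t.prod (R.simple_subset hα)
      rw [List.prod_cons, mul_smul, simpleReflection_smul_neg_iff hγ hΦ] at h
      -- The sign changes exactly at the letter `s`, so the tail carries `α` to the simple root of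
      -- `s`. Then `s` is the conjugate of the reflection in `α` by the tail, and multiplying by
      -- that reflection deletes `s`.
      have h1 : t.prod • α = γ := h.resolve_right fun h' => ht h'.1
      have h2 := smul_rootReflection t.prod (R.simple_subset hα)
      have h3 : R.rootReflection hΦ = R.simpleReflection hγ := by
        subst h1; rfl
      rw [h3] at h2
      rw [List.prod_cons, h2, simpleReflection, inv_mul_cancel_right, mul_assoc,
        rootReflection_mul_self, mul_one]

theorem length_mul_of_neg {w : R.W} {α : V} (hα : α ∈ R.Δ) (h : w • α ∈ R.negRoots) :
    R.length (w * R.simpleReflection hα) < R.length w := by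
  obtain ⟨l, hl, rfl, hlen⟩ := exists_reduced_word w
  obtain ⟨l', hl', h1, h2⟩ := exists_exchange l hl hα h
  rw [← hlen, ← h1]
  have := length_prod_le hl'
  omega

theorem length_mul_of_pos {w : R.W} {α : V} (hα : α ∈ R.Δ) (h : w • α ∈ R.posRoots) :
    R.length w < R.length (w * R.simpleReflection hα) := by
  have h1 : (w * R.simpleReflection hα) • α ∈ R.negRoots := by
    rw [mul_smul, simpleReflection_smul_self, smul_neg]
    exact neg_mem_negRoots.2 h
  have h2 := length_mul_of_neg hα h1
  rwa [mul_assoc, simpleReflection_mul_self, mul_one] at h2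

theorem length_lt_mul_iff {w : R.W} {α : V} (hα : α ∈ R.Δ) :
    R.length w < R.length (w * R.simpleReflection hα) ↔ w • α ∈ R.posRoots := by
  refine ⟨fun h => ?_, length_mul_of_pos hα⟩
  by_contra h'
  rw [not_pos_iff (smul_mem_roots _ (R.simple_subset hα))] at h'
  exact absurd h (not_lt.2 (length_mul_of_neg hα h').le)

theorem length_eq_ncard (w : R.W) : R.length w = (R.inversions w).ncard := by
  induction hn : R.length w generalizing w with
  | zero =>
    obtain ⟨l, hl, rfl, hlen⟩ := exists_reduced_word w
    rw [hn, List.length_eq_zero_iff] at hlen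
    subst hlen
    have : R.inversions (1 : R.W) = ∅ := by
      refine Set.eq_empty_of_forall_notMem ?_
      rintro β ⟨h1, h2⟩
      rw [inv_one, one_smul] at h2
      exact not_neg_of_pos h1 h2
    rw [List.prod_nil, this, Set.ncard_empty]
  | succ n ih =>
    obtain ⟨l, hl, hw, hlen⟩ := exists_reduced_word w
    have hne : l ≠ [] := by
      rintro rfl
      rw [hn] at hlen
      simp at hlen
    obtain ⟨l', s, rfl⟩ : ∃ l' s, l = l' ++ [s] := ⟨l.dropLast, l.getLast hne,
      (List.dropLast_append_getLast hne).symm⟩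
    obtain ⟨α, hα, rfl⟩ := exists_eq_simpleReflection (hl s (by simp))
    have h1 := length_prod_le (l := l') fun t ht => hl t (by simp [ht])
    have hprod : l'.prod = w * R.simpleReflection hα := by
      rw [← hw, List.prod_append, List.prod_singleton, mul_assoc, simpleReflection_mul_self,
        mul_one]
    rw [hprod] at h1
    rw [List.length_append, List.length_singleton, hn] at hlen
    have hlt : R.length (w * R.simpleReflection hα) < R.length w := by omega
    have hneg : w • α ∈ R.negRoots := by
      rw [← not_pos_iff (smul_mem_roots _ (R.simple_subset hα)), ← length_lt_mul_iff hα]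
      exact not_lt.2 hlt.le
    have h2 := length_mul_le (w * R.simpleReflection hα) (simpleReflection_mem hα)
    rw [mul_assoc, simpleReflection_mul_self, mul_one] at h2
    have h3 := ih (w * R.simpleReflection hα) (by omega)
    rw [inversions_mul_of_neg hα hneg] at h3
    have h4 := Set.ncard_sdiff_singleton_add_one (neg_smul_mem_inversions hα hneg)
      (finite_inversions w)
    omega

theorem eq_one_of_inversions {w : R.W} (h : R.inversions w = ∅) : w = 1 := by
  obtain ⟨l, -, rfl, hlen⟩ := exists_reduced_word w
  rw [length_eq_ncard, h, Set.ncard_empty, List.length_eq_zero_iff] at hlen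
  rw [hlen, List.prod_nil]

/-! ### The weak order through inversion sets -/

instance : Finite R.W := R.finite_W

/-- An inversion of `u⁻¹ * v` is either carried by `u` to a positive root inverted by `v` only, or
to the negative of a root inverted by `u` only. -/
theorem ncard_inversions_inv_mul (u v : R.W) :
    (R.inversions (u⁻¹ * v)).ncard =
      (R.inversions v \ R.inversions u).ncard + (R.inversions u \ R.inversions v).ncard := by
  have h1 : R.inversions (u⁻¹ * v) = (fun β => u⁻¹ • β) '' (R.inversions v \ R.inversions u) ∪
      (fun β => -(u⁻¹ • β)) '' (R.inversions u \ R.inversions v) := by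
    ext β
    constructor
    · rintro ⟨hβ, hn⟩
      rw [mul_inv_rev, inv_inv, mul_smul] at hn
      rcases pos_or_neg (smul_mem_roots u hβ.1) with hu | hu
      · refine Or.inl ⟨u • β, ⟨⟨hu, hn⟩, fun h => ?_⟩, inv_smul_smul u β⟩
        have h2 := h.2
        rw [inv_smul_smul] at h2
        exact not_neg_of_pos hβ h2
      · refine Or.inr ⟨-(u • β), ⟨⟨neg_mem_posRoots.2 hu, ?_⟩, fun h => ?_⟩, ?_⟩
        · rw [smul_neg, inv_smul_smul]
          exact neg_mem_negRoots.2 hβ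
        · have h2 := h.2
          rw [smul_neg, neg_mem_negRoots] at h2
          exact not_neg_of_pos h2 hn
        · simp only [smul_neg, inv_smul_smul, neg_neg]
    · rintro (⟨γ, ⟨h2, h3⟩, rfl⟩ | ⟨γ, ⟨h2, h3⟩, rfl⟩)
      · refine ⟨?_, ?_⟩
        · exact (not_neg_iff (smul_mem_roots _ h2.1.1)).1 fun h => h3 ⟨h2.1, h⟩
        · rw [mul_inv_rev, inv_inv, mul_smul, smul_inv_smul]
          exact h2.2
      · refine ⟨neg_mem_posRoots.2 h2.2, ?_⟩
        rw [mul_inv_rev, inv_inv, mul_smul, smul_neg, smul_neg, smul_inv_smul, neg_mem_negRoots]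
        exact (not_neg_iff (smul_mem_roots _ h2.1.1)).1 fun h => h3 ⟨h2.1, h⟩
  have hinj : Function.Injective fun β : V => u⁻¹ • β := MulAction.injective _
  have hinj' : Function.Injective fun β : V => -(u⁻¹ • β) := neg_injective.comp hinj
  rw [h1, Set.ncard_union_eq ?_ ((finite_inversions v).sdiff.image _)
    ((finite_inversions u).sdiff.image _), Set.ncard_image_of_injective _ hinj,
    Set.ncard_image_of_injective _ hinj']
  · rw [Set.disjoint_left]
    rintro _ ⟨γ, ⟨h2, -⟩, rfl⟩ ⟨δ, ⟨h3, -⟩, h4⟩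
    have h5 : -δ = γ := hinj ((smul_neg _ δ).trans h4)
    subst h5
    exact not_neg_of_pos h2.1 (neg_mem_negRoots.2 h3.1)

/-- The defect `ℓ(u) + ℓ(u⁻¹v) - ℓ(v)` is twice the number of inversions of `u` that are not
inversions of `v`. -/
theorem weakOrder_iff {u v : R.W} : u ≤ v ↔ R.inversions u ⊆ R.inversions v := by
  change R.length u + R.length (u⁻¹ * v) = R.length v ↔ _
  rw [length_eq_ncard, length_eq_ncard, length_eq_ncard, ncard_inversions_inv_mul,
    ← Set.sdiff_eq_empty, ← Set.ncard_eq_zero ((finite_inversions u).sdiff)]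
  have h1 := Set.ncard_inter_add_ncard_sdiff_eq_ncard (R.inversions v) (R.inversions u)
    (finite_inversions v)
  have h2 := Set.ncard_inter_add_ncard_sdiff_eq_ncard (R.inversions u) (R.inversions v)
    (finite_inversions u)
  rw [Set.inter_comm] at h2
  omega

theorem inversions_injective {u v : R.W} (h : R.inversions u = R.inversions v) : u = v := by
  have h1 := ncard_inversions_inv_mul u v
  rw [h, Set.sdiff_self, Set.ncard_empty, add_zero,
    Set.ncard_eq_zero (finite_inversions _)] at h1
  exact inv_mul_eq_one.1 (eq_one_of_inversions h1)

instance weakPartialOrder : PartialOrder R.W where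
  toLE := R.weakOrder
  le_refl u := weakOrder_iff.2 subset_rfl
  le_trans u v w h1 h2 :=
    weakOrder_iff.2 ((weakOrder_iff.1 h1).trans (weakOrder_iff.1 h2))
  le_antisymm u v h1 h2 :=
    inversions_injective ((weakOrder_iff.1 h1).antisymm (weakOrder_iff.1 h2))

theorem lt_mul_of_pos {w : R.W} {α : V} (hα : α ∈ R.Δ) (h : w • α ∈ R.posRoots) :
    w < w * R.simpleReflection hα := by
  refine lt_of_le_of_ne (weakOrder_iff.2 ?_) fun h' => ?_
  · rw [inversions_mul_of_pos hα h]
    exact Set.subset_insert _ _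
  · have := length_mul_of_pos hα h
    rw [← h'] at this
    exact this.false

theorem mul_lt_of_neg {w : R.W} {α : V} (hα : α ∈ R.Δ) (h : w • α ∈ R.negRoots) :
    w * R.simpleReflection hα < w := by
  refine lt_of_le_of_ne (weakOrder_iff.2 ?_) fun h' => ?_
  · rw [inversions_mul_of_neg hα h]
    exact Set.sdiff_subset
  · have := length_mul_of_neg hα h
    rw [h'] at this
    exact this.false

theorem exists_simple_neg {w : R.W} (h : w ≠ 1) : ∃ α ∈ R.Δ, w • α ∈ R.negRoots := by
  by_contra hno
  push Not at hno
  refine h (eq_one_of_inversions (Set.eq_empty_of_forall_notMem fun β hβ => ?_))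
  have h1 : w • (-(w⁻¹ • β)) ∈ PointedCone.hull ℝ R.Δ :=
    smul_mem_cone_of_forall w
      (fun α hα => ((not_neg_iff (smul_mem_roots _ (R.simple_subset hα))).1 (hno α hα)).2) hβ.2.2
  rw [smul_neg, smul_inv_smul] at h1
  exact not_neg_of_pos hβ.1 ⟨hβ.1.1, h1⟩

theorem le_mul_of_neg {u v : R.W} (h : u ≤ v) {α : V} (hα : α ∈ R.Δ) (hv : v • α ∈ R.negRoots)
    (hu : -(v • α) ∉ R.inversions u) : u ≤ v * R.simpleReflection hα := by
  rw [weakOrder_iff, inversions_mul_of_neg hα hv]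
  exact fun β hβ => ⟨weakOrder_iff.1 h hβ, fun h' => hu (h' ▸ hβ)⟩

theorem mul_le_of_pos {u v : R.W} (h : u ≤ v) {α : V} (hα : α ∈ R.Δ) (hu : u • α ∈ R.posRoots)
    (hv : u • α ∈ R.inversions v) : u * R.simpleReflection hα ≤ v := by
  rw [weakOrder_iff, inversions_mul_of_pos hα hu]
  exact Set.insert_subset hv (weakOrder_iff.1 h)

/-- Any right descent of `u⁻¹ * v` works: it is a descent of `v`, and the inversion of `v` that it
removes is not an inversion of `u`. -/
theorem exists_le_mul_of_lt {u v : R.W} (h : u < v) :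
    ∃ (α : V) (hα : α ∈ R.Δ), v • α ∈ R.negRoots ∧ u ≤ v * R.simpleReflection hα := by
  obtain ⟨α, hα, hn⟩ := exists_simple_neg (w := u⁻¹ * v) fun h' => h.ne (inv_mul_eq_one.1 h')
  rw [mul_smul] at hn
  have hΦ := smul_mem_roots v (R.simple_subset hα)
  have hv : v • α ∈ R.negRoots := by
    rw [← not_pos_iff hΦ]
    intro hp
    have h1 := weakOrder_iff.1 h.le ⟨hp, hn⟩
    exact smul_notMem_inversions hα h1
  refine ⟨α, hα, hv, le_mul_of_neg h.le hα hv fun h' => ?_⟩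
  have := h'.2
  rw [smul_neg, neg_mem_negRoots] at this
  exact not_neg_of_pos this hn

theorem exists_mul_le_of_lt {u v : R.W} (h : u < v) :
    ∃ (α : V) (hα : α ∈ R.Δ), u • α ∈ R.posRoots ∧ u * R.simpleReflection hα ≤ v := by
  obtain ⟨α, hα, hn⟩ := exists_simple_neg (w := v⁻¹ * u) fun h' => h.ne' (inv_mul_eq_one.1 h')
  rw [mul_smul] at hn
  have hΦ := smul_mem_roots u (R.simple_subset hα)
  have hu : u • α ∈ R.posRoots := by
    rw [← not_neg_iff hΦ]
    intro hm
    have h1 := (weakOrder_iff.1 h.le (neg_smul_mem_inversions hα hm)).2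
    rw [smul_neg, neg_mem_negRoots] at h1
    exact not_neg_of_pos h1 hn
  exact ⟨α, hα, hu, mul_le_of_pos h.le hα hu ⟨hu, hn⟩⟩

theorem mul_covBy_of_neg {w : R.W} {α : V} (hα : α ∈ R.Δ) (h : w • α ∈ R.negRoots) :
    w * R.simpleReflection hα ⋖ w := by
  refine ⟨mul_lt_of_neg hα h, fun t h1 h2 => ?_⟩
  have h3 := weakOrder_iff.1 h1.le
  have h4 := weakOrder_iff.1 h2.le
  rw [inversions_mul_of_neg hα h] at h3
  by_cases h5 : -(w • α) ∈ R.inversions t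
  · refine h2.not_ge (weakOrder_iff.2 fun β hβ => ?_)
    by_cases h6 : β = -(w • α)
    · rwa [h6]
    · exact h3 ⟨hβ, h6⟩
  · exact h1.not_ge (le_mul_of_neg h2.le hα h h5)

theorem covBy_mul_of_pos {w : R.W} {α : V} (hα : α ∈ R.Δ) (h : w • α ∈ R.posRoots) :
    w ⋖ w * R.simpleReflection hα := by
  have h1 : (w * R.simpleReflection hα) • α ∈ R.negRoots := by
    rw [mul_smul, simpleReflection_smul_self, smul_neg]
    exact neg_mem_negRoots.2 h
  have h2 := mul_covBy_of_neg hα h1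
  rwa [mul_assoc, simpleReflection_mul_self, mul_one] at h2

theorem exists_of_covBy_left {u v : R.W} (h : u ⋖ v) :
    ∃ (α : V) (hα : α ∈ R.Δ), v • α ∈ R.negRoots ∧ u = v * R.simpleReflection hα := by
  obtain ⟨α, hα, hn, hle⟩ := exists_le_mul_of_lt h.lt
  exact ⟨α, hα, hn, hle.eq_of_not_lt fun h' => h.2 h' (mul_lt_of_neg hα hn)⟩

theorem exists_of_covBy_right {u v : R.W} (h : u ⋖ v) :
    ∃ (α : V) (hα : α ∈ R.Δ), u • α ∈ R.posRoots ∧ v = u * R.simpleReflection hα := by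
  obtain ⟨α, hα, hp, hle⟩ := exists_mul_le_of_lt h.lt
  exact ⟨α, hα, hp, (hle.eq_of_not_lt fun h' => h.2 (lt_mul_of_pos hα hp) h').symm⟩

/-! ### Parabolic subgroups -/

variable (R) in
/-- The simple roots whose reflections lie in `I`. -/
def simples (I : Set R.W) : Set V :=
  {α | α ∈ R.Δ ∧ ∃ s ∈ I, (s : V ≃ₗᵢ[ℝ] V) = vectorReflection α}

theorem simples_subset (I : Set R.W) : R.simples I ⊆ R.Δ := fun _ h => h.1

theorem simples_mono {I J : Set R.W} (h : I ⊆ J) : R.simples I ⊆ R.simples J :=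
  fun _ ⟨h1, s, hs, h2⟩ => ⟨h1, s, h hs, h2⟩

theorem mem_simples_iff {I : Set R.W} {α : V} (hα : α ∈ R.Δ) :
    α ∈ R.simples I ↔ R.simpleReflection hα ∈ I := by
  constructor
  · rintro ⟨-, s, hs, h⟩
    rwa [show R.simpleReflection hα = s from Subtype.ext h.symm]
  · exact fun h => ⟨hα, _, h, rfl⟩

variable (R) in
/-- The positive roots in the span of the simple roots of `I`. -/
def posSpan (I : Set R.W) : Set V := R.posRoots ∩ PointedCone.hull ℝ (R.simples I)

theorem simple_mem_posSpan {I : Set R.W} {α : V} (h : α ∈ R.simples I) : α ∈ R.posSpan I :=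
  ⟨simple_pos h.1, Submodule.subset_span h⟩

theorem mem_simples_of_mem_posSpan {I : Set R.W} {α : V} (hα : α ∈ R.Δ) (h : α ∈ R.posSpan I) :
    α ∈ R.simples I := by
  by_contra hno
  have h1 := coord_eq_zero_of_mem_cone (simples_subset I) h.2 hno
  rw [coord_self hα] at h1
  exact one_ne_zero h1

/-- Generators of `W_I` only subtract multiples of simple roots of `I`. This confines the orbit
definition of `Φ_I` to a span, where coordinates can be used. -/
theorem coord_smul_of_mem_parabolic {I : Set R.W} (hI : I ⊆ R.S) {w : R.W}
    (hw : w ∈ R.parabolic I) {γ : V} (hγ : γ ∉ R.simples I) (p : V) :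
    R.coord γ (w • p) = R.coord γ p := by
  rw [parabolic] at hw
  induction hw using Subgroup.closure_induction generalizing p with
  | mem s hs =>
    obtain ⟨α, hα, rfl⟩ := exists_eq_simpleReflection (hI hs)
    have hne : α ≠ γ := by
      rintro rfl
      exact hγ ((mem_simples_iff hα).2 hs)
    rw [simpleReflection, rootReflection_smul, map_sub, map_smul, coord_of_ne hα hne, smul_zero,
      sub_zero]
  | one => rw [one_smul]
  | mul u v _ _ hu hv => rw [mul_smul, hu, hv]
  | inv u _ hu => rw [← hu (u⁻¹ • p), smul_inv_smul]

theorem parabolicRoots_inter_subset {I : Set R.W} (hI : I ⊆ R.S) :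
    R.parabolicRoots I ∩ R.posRoots ⊆ R.posSpan I := by
  rintro β ⟨⟨w, hw, α, hα, hs, rfl⟩, hp⟩
  refine ⟨hp, mem_cone_of_coord hp.2 fun γ _ hγ => ?_⟩
  change R.coord γ (w • α) = 0
  rw [coord_smul_of_mem_parabolic hI hw hγ]
  refine coord_of_ne hα ?_
  rintro rfl
  exact hγ ⟨hα, hs⟩

theorem inversions_subset_of_mem_parabolic {I : Set R.W} (hI : I ⊆ R.S) {w : R.W}
    (hw : w ∈ R.parabolic I) : R.inversions w ⊆ R.parabolicRoots I ∩ R.posRoots := by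
  have key : ∀ u ∈ R.parabolic I, ∀ s ∈ I,
      R.inversions u ⊆ R.parabolicRoots I ∩ R.posRoots →
      R.inversions (u * s) ⊆ R.parabolicRoots I ∩ R.posRoots := by
    intro u hu s hs ih
    obtain ⟨α, hα, rfl⟩ := exists_eq_simpleReflection (hI hs)
    rcases pos_or_neg (smul_mem_roots u (R.simple_subset hα)) with h | h
    · rw [inversions_mul_of_pos hα h]
      exact Set.insert_subset ⟨⟨u, hu, α, hα, ((mem_simples_iff hα).2 hs).2, rfl⟩, h⟩ ih
    · rw [inversions_mul_of_neg hα h]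
      exact Set.sdiff_subset.trans ih
  rw [parabolic] at hw
  induction hw using Subgroup.closure_induction_right with
  | one =>
    rintro β ⟨h1, h2⟩
    rw [inv_one, one_smul] at h2
    exact absurd h2 (not_neg_of_pos h1)
  | mul_right u hu s hs ih => exact key u hu s hs ih
  | mul_inv_cancel u hu s hs ih =>
    rw [inv_mem_simple (hI hs)]
    exact key u hu s hs ih

theorem longest_mem (I : Set R.W) : R.longest I ∈ R.parabolic I :=
  (R.exists_longest I).choose_spec.1

theorem length_le_longest {I : Set R.W} {w : R.W} (hw : w ∈ R.parabolic I) :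
    R.length w ≤ R.length (R.longest I) :=
  (R.exists_longest I).choose_spec.2 w hw

/-- A longest element has no ascent in `I`, so it makes every simple root of `I` negative, hence
their whole cone. -/
theorem longest_smul_neg {I : Set R.W} {β : V} (hβ : β ∈ R.posSpan I) :
    R.longest I • β ∈ R.negRoots := by
  refine ⟨smul_mem_roots _ hβ.1.1, neg_smul_mem_cone_of_forall _ (fun α hα => ?_) hβ.2⟩
  refine ((not_pos_iff (smul_mem_roots _ (R.simple_subset hα.1))).1 fun h => ?_).2
  have h1 := length_mul_of_pos hα.1 h
  exact h1.not_ge (length_le_longest (Subgroup.mul_mem _ (longest_mem I)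
    (Subgroup.subset_closure ((mem_simples_iff hα.1).1 hα))))

theorem posSpan_subset_inversions (I : Set R.W) :
    R.posSpan I ⊆ R.inversions (R.longest I)⁻¹ := fun β hβ =>
  ⟨hβ.1, by rw [inv_inv]; exact longest_smul_neg hβ⟩

theorem parabolicRoots_inter {I : Set R.W} (hI : I ⊆ R.S) :
    R.parabolicRoots I ∩ R.posRoots = R.posSpan I :=
  (parabolicRoots_inter_subset hI).antisymm ((posSpan_subset_inversions I).trans
    (inversions_subset_of_mem_parabolic hI (Subgroup.inv_mem _ (longest_mem I))))

theorem inversions_longest_inv {I : Set R.W} (hI : I ⊆ R.S) :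
    R.inversions (R.longest I)⁻¹ = R.posSpan I := by
  refine (posSpan_subset_inversions I).antisymm' ?_
  rw [← parabolicRoots_inter hI]
  exact inversions_subset_of_mem_parabolic hI (Subgroup.inv_mem _ (longest_mem I))

/-- All inversions of an element of `W_I` lie in `Φ_I⁺`, which is exactly the inversion set of the
inverse of the longest element; maximality of length then forces equality. -/
theorem longest_inv {I : Set R.W} (hI : I ⊆ R.S) : (R.longest I)⁻¹ = R.longest I := by
  refine (inversions_injective (Set.eq_of_subset_of_ncard_le ?_ ?_ (finite_inversions _))).symm
  · rw [inversions_longest_inv hI, ← parabolicRoots_inter hI]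
    exact inversions_subset_of_mem_parabolic hI (longest_mem I)
  · rw [← length_eq_ncard, ← length_eq_ncard]
    exact length_le_longest (Subgroup.inv_mem _ (longest_mem I))

theorem longest_mul_self {I : Set R.W} (hI : I ⊆ R.S) : R.longest I * R.longest I = 1 := by
  conv_lhs => arg 1; rw [← longest_inv hI]
  exact inv_mul_cancel _

theorem longest_smul_longest_smul {I : Set R.W} (hI : I ⊆ R.S) (x : V) :
    R.longest I • R.longest I • x = x := by
  rw [← mul_smul, longest_mul_self hI, one_smul]

theorem neg_longest_smul_mem {I : Set R.W} (hI : I ⊆ R.S) {β : V} (hβ : β ∈ R.posSpan I) :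
    -(R.longest I • β) ∈ R.posSpan I := by
  have h1 := neg_mem_posRoots.2 (longest_smul_neg hβ)
  refine ⟨h1, mem_cone_of_coord h1.2 fun γ _ hγ => ?_⟩
  rw [map_neg, coord_smul_of_mem_parabolic hI (longest_mem I) hγ,
    coord_eq_zero_of_mem_cone (simples_subset I) hβ.2 hγ, neg_zero]

theorem longest_smul_neg_iff {I : Set R.W} (hI : I ⊆ R.S) {β : V} (hβ : β ∈ R.Φ) :
    R.longest I • β ∈ R.negRoots ↔ β ∈ R.posSpan I ∨ (β ∈ R.negRoots ∧ -β ∉ R.posSpan I) := by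
  have key : ∀ γ ∈ R.posRoots, R.longest I • γ ∈ R.negRoots ↔ γ ∈ R.posSpan I := by
    intro γ hγ
    rw [← inversions_longest_inv hI]
    simp only [inversions, Set.mem_ofPred_eq, inv_inv, hγ, true_and]
  rcases pos_or_neg hβ with h | h
  · rw [key β h]
    exact ⟨Or.inl, fun h' => h'.resolve_right fun h2 => not_neg_of_pos h h2.1⟩
  · have h1 : β ∉ R.posSpan I := fun h2 => not_neg_of_pos h2.1 h
    rw [← key (-β) (neg_mem_posRoots.2 h), smul_neg, neg_mem_negRoots,
      not_pos_iff (smul_mem_roots _ hβ)]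
    tauto

theorem mem_minReps_iff {I : Set R.W} (hI : I ⊆ R.S) {x : R.W} :
    x ∈ R.minReps I ↔ ∀ α ∈ R.simples I, x • α ∈ R.posRoots := by
  constructor
  · intro h α hα
    exact (length_lt_mul_iff hα.1).1 (h _ ((mem_simples_iff hα.1).1 hα))
  · intro h s hs
    obtain ⟨α, hα, rfl⟩ := exists_eq_simpleReflection (hI hs)
    exact length_mul_of_pos hα (h α ((mem_simples_iff hα).2 hs))

theorem smul_posSpan_pos {I : Set R.W} {x : R.W} (hx : ∀ α ∈ R.simples I, x • α ∈ R.posRoots)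
    {β : V} (hβ : β ∈ R.posSpan I) : x • β ∈ R.posRoots :=
  ⟨smul_mem_roots _ hβ.1.1, smul_mem_cone_of_forall _ (fun α hα => (hx α hα).2) hβ.2⟩

theorem smul_posSpan_neg {I : Set R.W} {x : R.W} (hx : ∀ α ∈ R.simples I, x • α ∈ R.negRoots)
    {β : V} (hβ : β ∈ R.posSpan I) : x • β ∈ R.negRoots :=
  ⟨smul_mem_roots _ hβ.1.1, neg_smul_mem_cone_of_forall _ (fun α hα => (hx α hα).2) hβ.2⟩

theorem mem_inversions_mul_longest_iff {I : Set R.W} (hI : I ⊆ R.S) {x : R.W}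
    (hx : ∀ α ∈ R.simples I, x • α ∈ R.posRoots) {β : V} :
    β ∈ R.inversions (x * R.longest I) ↔ β ∈ R.inversions x ∨ x⁻¹ • β ∈ R.posSpan I := by
  simp only [inversions, Set.mem_ofPred_eq, mul_inv_rev, longest_inv hI, mul_smul]
  constructor
  · rintro ⟨h1, h2⟩
    rcases (longest_smul_neg_iff hI (smul_mem_roots _ h1.1)).1 h2 with h | h
    · exact Or.inr h
    · exact Or.inl ⟨h1, h.1⟩
  · rintro (⟨h1, h2⟩ | h)
    · refine ⟨h1, (longest_smul_neg_iff hI h2.1).2 (Or.inr ⟨h2, fun h3 => ?_⟩)⟩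
      have h4 := smul_posSpan_pos hx h3
      rw [smul_neg, smul_inv_smul] at h4
      exact not_neg_of_pos h4 (neg_mem_negRoots.2 h1)
    · have h1 := smul_posSpan_pos hx h
      rw [smul_inv_smul] at h1
      exact ⟨h1, longest_smul_neg h⟩

theorem mem_inversions_mul_longest_iff_of_neg {K : Set R.W} (hK : K ⊆ R.S) {z : R.W}
    (hz : ∀ α ∈ R.simples K, z • α ∈ R.negRoots) {β : V} :
    β ∈ R.inversions (z * R.longest K) ↔ β ∈ R.inversions z ∧ -(z⁻¹ • β) ∉ R.posSpan K := by
  simp only [inversions, Set.mem_ofPred_eq, mul_inv_rev, longest_inv hK, mul_smul]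
  constructor
  · rintro ⟨h1, h2⟩
    rcases (longest_smul_neg_iff hK (smul_mem_roots _ h1.1)).1 h2 with h | h
    · have h3 := smul_posSpan_neg hz h
      rw [smul_inv_smul] at h3
      exact absurd h3 (not_neg_of_pos h1)
    · exact ⟨⟨h1, h.1⟩, h.2⟩
  · rintro ⟨⟨h1, h2⟩, h3⟩
    exact ⟨h1, (longest_smul_neg_iff hK h2.1).2 (Or.inr ⟨h2, h3⟩)⟩

theorem mul_longest_smul_pos {K : Set R.W} (hK : K ⊆ R.S) {z : R.W}
    (hz : ∀ α ∈ R.simples K, z • α ∈ R.negRoots) {β : V} (hβ : β ∈ R.posSpan K) :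
    (z * R.longest K) • β ∈ R.posRoots := by
  have h := smul_posSpan_neg hz (neg_longest_smul_mem hK hβ)
  rwa [smul_neg, neg_mem_negRoots, ← mul_smul] at h

theorem mul_longest_smul_neg {I : Set R.W} (hI : I ⊆ R.S) {x : R.W}
    (hx : ∀ α ∈ R.simples I, x • α ∈ R.posRoots) {β : V} (hβ : β ∈ R.posSpan I) :
    (x * R.longest I) • β ∈ R.negRoots := by
  have h := smul_posSpan_pos hx (neg_longest_smul_mem hI hβ)
  rwa [smul_neg, neg_mem_posRoots, ← mul_smul] at h

/-- For an upper bound `y`, the element `y⁻¹ * x` makes the simple roots of `I` negative, hence all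
of `Φ_I⁺`. These are the only roots, up to `x`, that the longest element adds to the inversions of
`x`. -/
theorem isLUB_mul_longest {I : Set R.W} (hI : I ⊆ R.S) {x : R.W}
    (hx : ∀ α ∈ R.simples I, x • α ∈ R.posRoots) :
    IsLUB (insert x ((x * ·) '' I)) (x * R.longest I) := by
  have hle : x ≤ x * R.longest I :=
    weakOrder_iff.2 fun β hβ => (mem_inversions_mul_longest_iff hI hx).2 (Or.inl hβ)
  constructor
  · rintro _ (rfl | ⟨s, hs, rfl⟩)
    · exact hle
    · obtain ⟨α, hα, rfl⟩ := exists_eq_simpleReflection (hI hs)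
      have hαI := (mem_simples_iff hα).2 hs
      refine mul_le_of_pos hle hα (hx α hαI) ((mem_inversions_mul_longest_iff hI hx).2 (Or.inr ?_))
      rw [inv_smul_smul]
      exact simple_mem_posSpan hαI
  · intro y hy
    have hxy : x ≤ y := hy (Set.mem_insert _ _)
    refine weakOrder_iff.2 fun β hβ => ?_
    rcases (mem_inversions_mul_longest_iff hI hx).1 hβ with h | h
    · exact weakOrder_iff.1 hxy h
    · have h1 : (y⁻¹ * x) • x⁻¹ • β ∈ R.negRoots := by
        refine smul_posSpan_neg (fun α hα => ?_) h
        have h2 : x * R.simpleReflection hα.1 ≤ y :=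
          hy (Set.mem_insert_of_mem _ ⟨_, (mem_simples_iff hα.1).1 hα, rfl⟩)
        have h3 := weakOrder_iff.1 h2
        rw [inversions_mul_of_pos hα.1 (hx α hα)] at h3
        rw [mul_smul]
        exact (h3 (Set.mem_insert _ _)).2
      rw [mul_smul, smul_inv_smul] at h1
      exact ⟨hβ.1, h1⟩

theorem isGLB_mul_longest {K : Set R.W} (hK : K ⊆ R.S) {z : R.W}
    (hz : ∀ α ∈ R.simples K, z • α ∈ R.negRoots) :
    IsGLB (insert z ((z * ·) '' K)) (z * R.longest K) := by
  have hle : z * R.longest K ≤ z :=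
    weakOrder_iff.2 fun β hβ => ((mem_inversions_mul_longest_iff_of_neg hK hz).1 hβ).1
  constructor
  · rintro _ (rfl | ⟨s, hs, rfl⟩)
    · exact hle
    · obtain ⟨α, hα, rfl⟩ := exists_eq_simpleReflection (hK hs)
      have hαK := (mem_simples_iff hα).2 hs
      refine le_mul_of_neg hle hα (hz α hαK) fun h => ?_
      have h1 := ((mem_inversions_mul_longest_iff_of_neg hK hz).1 h).2
      rw [smul_neg, neg_neg, inv_smul_smul] at h1
      exact h1 (simple_mem_posSpan hαK)
  · intro y hy
    have hyz : y ≤ z := hy (Set.mem_insert _ _)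
    refine weakOrder_iff.2 fun β hβ => (mem_inversions_mul_longest_iff_of_neg hK hz).2
      ⟨weakOrder_iff.1 hyz hβ, fun h => ?_⟩
    have h1 : (y⁻¹ * z) • -(z⁻¹ • β) ∈ R.negRoots := by
      refine smul_posSpan_neg (fun α hα => ?_) h
      have h2 : y ≤ z * R.simpleReflection hα.1 :=
        hy (Set.mem_insert_of_mem _ ⟨_, (mem_simples_iff hα.1).1 hα, rfl⟩)
      have h3 := weakOrder_iff.1 h2
      rw [inversions_mul_of_neg hα.1 (hz α hα)] at h3
      have h4 : -(z • α) ∉ R.inversions y := fun h5 => (h3 h5).2 rfl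
      have h5 := neg_mem_posRoots.2 (hz α hα)
      rw [mul_smul, ← not_pos_iff (smul_mem_roots _ (smul_mem_roots _ (R.simple_subset hα.1)))]
      intro h6
      refine h4 ⟨h5, ?_⟩
      rw [smul_neg]
      exact neg_mem_negRoots.2 h6
    rw [mul_smul, smul_neg, smul_inv_smul, smul_neg, neg_mem_negRoots] at h1
    exact not_neg_of_pos h1 hβ.2

/-! ### The weak order is a lattice -/

theorem simples_S : R.simples R.S = R.Δ :=
  (simples_subset _).antisymm fun _ hα => (mem_simples_iff hα).2 (simpleReflection_mem hα)

theorem weakOrder_one_le (w : R.W) : 1 ≤ w := by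
  refine weakOrder_iff.2 ?_
  rintro β ⟨h1, h2⟩
  rw [inv_one, one_smul] at h2
  exact absurd h2 (not_neg_of_pos h1)

theorem weakOrder_le_longest (w : R.W) : w ≤ R.longest R.S := by
  rw [← longest_inv subset_rfl, weakOrder_iff, inversions_longest_inv subset_rfl, posSpan,
    simples_S]
  exact fun β hβ => ⟨hβ.1, hβ.1.2⟩

theorem simpleReflection_injective {α β : V} (hα : α ∈ R.Δ) (hβ : β ∈ R.Δ)
    (h : R.simpleReflection hα = R.simpleReflection hβ) : α = β := by
  rcases eq_or_eq_neg_of_vectorReflection_eq (R.simple_subset hβ) (R.simple_subset hα)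
    (congrArg Subtype.val h).symm with h1 | h1
  · exact h1
  · subst h1
    exact absurd (simple_pos hβ) fun h2 => not_neg_of_pos (simple_pos hα) (neg_mem_negRoots.2 h2)

/-- Two covers of `z` by simple reflections have as join `z` times the longest element of the
parabolic subgroup they generate, so the local criterion applies from the identity upward. -/
theorem exists_isLUB (u v : R.W) : ∃ j, IsLUB {u, v} j := by
  refine exists_isLUB_of_covBy (fun z a b ha hb => ?_) 1 u v (weakOrder_one_le u)
    (weakOrder_one_le v)
  obtain ⟨α, hα, hzα, rfl⟩ := exists_of_covBy_right ha
  obtain ⟨β, hβ, hzβ, rfl⟩ := exists_of_covBy_right hb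
  have hI : {R.simpleReflection hα, R.simpleReflection hβ} ⊆ R.S :=
    Set.insert_subset (simpleReflection_mem hα)
      (Set.singleton_subset_iff.2 (simpleReflection_mem hβ))
  have h := isLUB_mul_longest (x := z) hI fun γ hγ => ?_
  · rw [Set.image_pair] at h
    exact ⟨_, fun t ht => h.1 (Set.mem_insert_of_mem _ ht), fun t ht => h.2
      (Set.forall_insert_of_forall ht (ha.le.trans (ht (Set.mem_insert _ _))))⟩
  · rcases (mem_simples_iff hγ.1).1 hγ with h1 | h1
    · rwa [simpleReflection_injective _ _ h1]
    · rwa [simpleReflection_injective _ _ h1]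

theorem exists_isGLB (u v : R.W) : ∃ j, IsGLB {u, v} j := by
  refine exists_isLUB_of_covBy (P := R.Wᵒᵈ) (fun z a b ha hb => ?_) (R.longest R.S) u v
    (weakOrder_le_longest u) (weakOrder_le_longest v)
  obtain ⟨α, hα, hzα, rfl⟩ := exists_of_covBy_left (R := R) ha.ofDual
  obtain ⟨β, hβ, hzβ, rfl⟩ := exists_of_covBy_left (R := R) hb.ofDual
  have hI : {R.simpleReflection hα, R.simpleReflection hβ} ⊆ R.S :=
    Set.insert_subset (simpleReflection_mem hα)
      (Set.singleton_subset_iff.2 (simpleReflection_mem hβ))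
  have h := isGLB_mul_longest (z := OrderDual.ofDual z) hI fun γ hγ => ?_
  · rw [Set.image_pair] at h
    exact ⟨_, fun t ht => h.1 (Set.mem_insert_of_mem _ ht), fun t ht => h.2
      (Set.forall_insert_of_forall ht (ha.le.trans (ht (Set.mem_insert _ _))))⟩
  · rcases (mem_simples_iff hγ.1).1 hγ with h1 | h1
    · rwa [simpleReflection_injective _ _ h1]
    · rwa [simpleReflection_injective _ _ h1]

instance weakLattice : Lattice R.W where
  sup u v := (exists_isLUB u v).choose
  inf u v := (exists_isGLB u v).choose
  le_sup_left u v := (exists_isLUB u v).choose_spec.1 (by simp)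
  le_sup_right u v := (exists_isLUB u v).choose_spec.1 (by simp)
  sup_le u v w hu hv := (exists_isLUB u v).choose_spec.2 (by rintro t (rfl | rfl) <;> assumption)
  inf_le_left u v := (exists_isGLB u v).choose_spec.1 (by simp)
  inf_le_right u v := (exists_isGLB u v).choose_spec.1 (by simp)
  le_inf u v w hu hv := (exists_isGLB v w).choose_spec.2 (by rintro t (rfl | rfl) <;> assumption)

/-! ### The facial weak order -/

theorem length_le_of_le {u v : R.W} (h : u ≤ v) : R.length u ≤ R.length v := by
  have h' : R.length u + R.length (u⁻¹ * v) = R.length v := h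
  omega

theorem eq_of_le_of_length_le {u v : R.W} (h : u ≤ v) (hl : R.length v ≤ R.length u) : u = v := by
  rw [length_eq_ncard, length_eq_ncard] at hl
  exact inversions_injective
    (Set.eq_of_subset_of_ncard_le (weakOrder_iff.1 h) hl (finite_inversions v))

theorem subset_of_simples_subset {I J : Set R.W} (hI : I ⊆ R.S) (h : R.simples I ⊆ R.simples J) :
    I ⊆ J := by
  intro s hs
  obtain ⟨α, hα, rfl⟩ := exists_eq_simpleReflection (hI hs)
  exact (mem_simples_iff hα).1 (h ((mem_simples_iff hα).2 hs))

theorem subset_of_posSpan_subset {I J : Set R.W} (hI : I ⊆ R.S) (h : R.posSpan I ⊆ R.posSpan J) :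
    I ⊆ J :=
  subset_of_simples_subset hI fun _ hα =>
    mem_simples_of_mem_posSpan hα.1 (h (simple_mem_posSpan hα))

theorem longest_injOn {I J : Set R.W} (hI : I ⊆ R.S) (hJ : J ⊆ R.S)
    (h : R.longest I = R.longest J) : I = J := by
  have h1 : R.posSpan I = R.posSpan J := by
    rw [← inversions_longest_inv hI, ← inversions_longest_inv hJ, h]
  exact (subset_of_posSpan_subset hI h1.le).antisymm (subset_of_posSpan_subset hJ h1.ge)

namespace ParabolicCoset

theorem rep_smul_pos (c : R.ParabolicCoset) : ∀ α ∈ R.simples c.type, c.rep • α ∈ R.posRoots :=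
  (mem_minReps_iff c.type_subset).1 c.rep_mem

theorem maxRep_smul_neg (c : R.ParabolicCoset) :
    ∀ α ∈ R.simples c.type, c.maxRep • α ∈ R.negRoots := fun _ hα =>
  mul_longest_smul_neg c.type_subset c.rep_smul_pos (simple_mem_posSpan hα)

theorem maxRep_mul_longest (c : R.ParabolicCoset) : c.maxRep * R.longest c.type = c.rep := by
  rw [maxRep, mul_assoc, longest_mul_self c.type_subset, mul_one]

theorem isLUB_maxRep (c : R.ParabolicCoset) :
    IsLUB (insert c.rep ((c.rep * ·) '' c.type)) c.maxRep :=
  isLUB_mul_longest c.type_subset c.rep_smul_pos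

theorem isGLB_rep (c : R.ParabolicCoset) :
    IsGLB (insert c.maxRep ((c.maxRep * ·) '' c.type)) c.rep := by
  have h := isGLB_mul_longest c.type_subset c.maxRep_smul_neg
  rwa [maxRep_mul_longest] at h

theorem rep_le_maxRep (c : R.ParabolicCoset) : c.rep ≤ c.maxRep :=
  c.isGLB_rep.1 (Set.mem_insert _ _)

theorem ext_rep {c d : R.ParabolicCoset} (h : c.rep = d.rep) (h' : c.maxRep = d.maxRep) :
    c = d := by
  refine ParabolicCoset.ext h (longest_injOn c.type_subset d.type_subset ?_)
  rw [maxRep, maxRep, h] at h'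
  exact mul_left_cancel h'

theorem mem_inversions_maxRep {c : R.ParabolicCoset} {β : V} :
    β ∈ R.inversions c.maxRep ↔ β ∈ R.inversions c.rep ∨ c.rep⁻¹ • β ∈ R.posSpan c.type :=
  mem_inversions_mul_longest_iff c.type_subset c.rep_smul_pos

/-- The coset with a prescribed maximal length representative. -/
def ofMaxRep (z : R.W) (K : Set R.W) (hK : K ⊆ R.S)
    (hz : ∀ α ∈ R.simples K, z • α ∈ R.negRoots) : R.ParabolicCoset where
  rep := z * R.longest K
  type := K
  type_subset := hK
  rep_mem := (mem_minReps_iff hK).2 fun _ hα => mul_longest_smul_pos hK hz (simple_mem_posSpan hα)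

theorem maxRep_ofMaxRep {z : R.W} {K : Set R.W} (hK : K ⊆ R.S)
    (hz : ∀ α ∈ R.simples K, z • α ∈ R.negRoots) : (ofMaxRep z K hK hz).maxRep = z := by
  change z * R.longest K * R.longest K = z
  rw [mul_assoc, longest_mul_self hK, mul_one]

end ParabolicCoset

theorem maxRep_le_of_subset {c d : R.ParabolicCoset} (h : c.rep = d.rep) (hI : c.type ⊆ d.type) :
    c.maxRep ≤ d.maxRep := by
  refine c.isLUB_maxRep.mono d.isLUB_maxRep ?_
  rw [h]
  exact Set.insert_subset_insert (Set.image_mono hI)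

theorem FacialCover.maxRep_eq {c d : R.ParabolicCoset} {s : R.W}
    (htype : d.type = c.type \ {s})
    (hrep : d.rep = c.rep * R.longest c.type * R.longest (c.type \ {s})) :
    d.maxRep = c.maxRep := by
  rw [ParabolicCoset.maxRep, hrep, htype, mul_assoc, longest_mul_self, mul_one]
  · rfl
  · exact Set.sdiff_subset.trans c.type_subset

theorem FacialCover.le {c d : R.ParabolicCoset} (h : FacialCover c d) :
    c.rep ≤ d.rep ∧ c.maxRep ≤ d.maxRep := by
  cases h with
  | up s hs hI htype hrep =>
    exact ⟨hrep.ge, maxRep_le_of_subset hrep.symm (htype ▸ Set.subset_insert _ _)⟩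
  | down s hI htype hrep =>
    have h := FacialCover.maxRep_eq htype hrep
    refine ⟨?_, h.ge⟩
    refine d.isGLB_rep.mono c.isGLB_rep ?_
    rw [h, htype]
    exact Set.insert_subset_insert (Set.image_mono Set.sdiff_subset)

theorem FacialCover.ne {c d : R.ParabolicCoset} (h : FacialCover c d) : c ≠ d := by
  rintro rfl
  cases h with
  | up s hs hI htype hrep => exact hI (htype ▸ Set.mem_insert s _)
  | down s hI htype hrep =>
    rw [htype] at hI
    exact hI.2 rfl

theorem le_of_facial_le {c d : R.ParabolicCoset} (h : c ≤ d) :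
    c.rep ≤ d.rep ∧ c.maxRep ≤ d.maxRep := by
  induction h with
  | refl => exact ⟨le_rfl, le_rfl⟩
  | tail _ h ih => exact ⟨ih.1.trans h.le.1, ih.2.trans h.le.2⟩

/-- A sum of nonpositive terms vanishes only termwise. -/
theorem eq_zero_of_coord_ne_zero {D : Set V} (hD : D ⊆ R.Δ) (f : V →ₗ[ℝ] ℝ)
    (hf : ∀ α ∈ D, f α ≤ 0) {δ : V} (hδ : δ ∈ PointedCone.hull ℝ D) (h : f δ = 0) {τ : V}
    (hτ : τ ∈ D) (hne : R.coord τ δ ≠ 0) : f τ = 0 := by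
  have hδ' : δ ∈ PointedCone.hull ℝ R.Δ := Submodule.span_mono hD hδ
  rw [eq_sum_coord hδ', map_sum, Finset.sum_eq_zero_iff_of_nonpos] at h
  · have h1 := h τ (by simpa using hD hτ)
    rw [map_smul, smul_eq_mul] at h1
    exact (mul_eq_zero.1 h1).resolve_left hne
  · intro α _
    rw [map_smul, smul_eq_mul]
    by_cases hα : α ∈ D
    · exact mul_nonpos_of_nonneg_of_nonpos (coord_nonneg α hδ') (hf α hα)
    · rw [coord_eq_zero_of_mem_cone hD hδ hα, zero_mul]

theorem mem_posSpan_sdiff {I : Set R.W} {τ : V} (hτ : τ ∈ R.Δ) {δ : V} (hδ : δ ∈ R.posSpan I)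
    (h : R.coord τ δ = 0) : δ ∈ R.posSpan (I \ {R.simpleReflection hτ}) := by
  refine ⟨hδ.1, mem_cone_of_coord hδ.1.2 fun α hα hno => ?_⟩
  by_cases hατ : α = τ
  · rw [hατ, h]
  · refine coord_eq_zero_of_mem_cone (simples_subset I) hδ.2 fun hαI => hno ?_
    rw [mem_simples_iff hα] at hαI ⊢
    exact ⟨hαI, fun h' => hατ (simpleReflection_injective _ _ h')⟩

/-- A coset that lies below `d` in the sense of extreme representatives and whose minimal
representative has an atom of the coset below `d.rep` can be moved up towards `d` by removing a
simple reflection from its type. -/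
theorem exists_down_step {c d : R.ParabolicCoset} (hrep : c.rep ≤ d.rep)
    (hmax : c.maxRep ≤ d.maxRep) {α : V} (hα : α ∈ R.simples c.type)
    (hαd : c.rep • α ∈ R.inversions d.rep) :
    ∃ c', FacialCover c c' ∧ c'.rep ≤ d.rep ∧ c'.maxRep ≤ d.maxRep := by
  set I := c.type with hIdef
  have hIS : I ⊆ R.S := c.type_subset
  set x := c.rep
  set y := d.rep
  set wI := R.longest I with hwI
  have hgα : y⁻¹ • x • α ∈ R.negRoots := hαd.2
  -- The roots `-(wI • τ)` are again positive roots of `Φ_I` whose cone contains `α`; since `y⁻¹ *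
  -- x` makes `α` negative, it makes one of them negative. That `τ` is the reflection to drop.
  obtain ⟨τ, hτ, hτn⟩ : ∃ τ ∈ R.simples I, y⁻¹ • x • -(wI • τ) ∈ R.negRoots := by
    by_contra hno
    push Not at hno
    have h1 := neg_smul_mem_cone_of_forall (D := R.simples I) (E := R.Δ) (y⁻¹ * x * wI)
      (fun τ hτ => by
        have h2 := hno τ hτ
        rw [not_neg_iff (smul_mem_roots _ (smul_mem_roots _
          (neg_mem_roots (smul_mem_roots _ (R.simple_subset hτ.1)))))] at h2
        have h3 := h2.2
        rwa [smul_neg, smul_neg, ← mul_smul, ← mul_smul] at h3)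
      (neg_longest_smul_mem hIS (simple_mem_posSpan hα)).2
    rw [smul_neg, neg_neg, mul_smul, longest_smul_longest_smul hIS, mul_smul] at h1
    exact not_neg_of_pos ⟨hgα.1, h1⟩ hgα
  set s := R.simpleReflection hτ.1
  have hs : s ∈ I := (mem_simples_iff hτ.1).1 hτ
  have hKI : I \ {s} ⊆ I := Set.sdiff_subset
  have hneg : ∀ β ∈ R.simples (I \ {s}), c.maxRep • β ∈ R.negRoots := fun β hβ =>
    c.maxRep_smul_neg β (simples_mono hKI hβ)
  have hinv : ∀ γ ∈ R.posSpan I, x • γ ∈ R.inversions y ∨ y⁻¹ • x • γ ∈ R.posSpan d.type := by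
    intro γ hγ
    refine ParabolicCoset.mem_inversions_maxRep.1 (weakOrder_iff.1 hmax
      (ParabolicCoset.mem_inversions_maxRep.2 (Or.inr ?_)))
    rwa [inv_smul_smul]
  refine ⟨ParabolicCoset.ofMaxRep c.maxRep (I \ {s}) (hKI.trans hIS) hneg,
    FacialCover.down _ _ s hs rfl rfl, ?_, ?_⟩
  · refine weakOrder_iff.2 fun β hβ => ?_
    obtain ⟨h1, h2⟩ := (mem_inversions_mul_longest_iff_of_neg (hKI.trans hIS) hneg).1 hβ
    rcases ParabolicCoset.mem_inversions_maxRep.1 h1 with h3 | h3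
    · exact weakOrder_iff.1 hrep h3
    by_contra hβy
    set γ := x⁻¹ • β with hγ
    have hβγ : β = x • γ := (smul_inv_smul x β).symm
    have h4 : y⁻¹ • x • γ ∈ R.posSpan d.type := (hinv γ h3).resolve_left (hβγ ▸ hβy)
    have h5 : -(c.maxRep⁻¹ • β) = -(wI • γ) := by
      rw [ParabolicCoset.maxRep, mul_inv_rev, longest_inv c.type_subset, mul_smul]
    rw [h5] at h2
    have hδ := neg_longest_smul_mem hIS h3
    have hne : R.coord τ (-(wI • γ)) ≠ 0 := fun h => h2 (mem_posSpan_sdiff hτ.1 hδ h)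
    -- For `j` outside the type of `d`, the `j`-coordinate of `y⁻¹ • x • -(wI • ρ)` is nonpositive
    -- for each simple `ρ` of `I`, and these sum with the coefficients of `-(wI • γ)` to zero. Since
    -- `τ` occurs there, its own contribution vanishes.
    have h6 : -(y⁻¹ • x • -(wI • τ)) ∈ PointedCone.hull ℝ (R.simples d.type) := by
      refine mem_cone_of_coord hτn.2 fun j hj hjJ => ?_
      have h7 := eq_zero_of_coord_ne_zero (simples_subset I)
        ((R.coord j).comp (-((y⁻¹ * x * wI : R.W) : V ≃ₗᵢ[ℝ] V).toLinearEquiv.toLinearMap))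
        (fun ρ hρ => ?_) hδ.2 ?_ hτ hne
      · change R.coord j (-((y⁻¹ * x * wI) • τ)) = 0 at h7
        rw [smul_neg, smul_neg, neg_neg, ← mul_smul, ← mul_smul]
        rwa [map_neg, neg_eq_zero] at h7
      · change R.coord j (-((y⁻¹ * x * wI) • ρ)) ≤ 0
        rw [mul_smul, mul_smul, ← smul_neg, ← smul_neg]
        rcases hinv _ (neg_longest_smul_mem hIS (simple_mem_posSpan hρ)) with h8 | h8
        · have h9 := coord_nonneg j h8.2.2
          rw [map_neg] at h9
          linarith
        · exact (coord_eq_zero_of_mem_cone (simples_subset _) h8.2 hjJ).le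
      · change R.coord j (-((y⁻¹ * x * wI) • -(wI • γ))) = 0
        rw [smul_neg, neg_neg, mul_smul, longest_smul_longest_smul hIS, mul_smul]
        exact coord_eq_zero_of_mem_cone (simples_subset _) h4.2 hjJ
    -- Now `y` keeps this root of `Φ_J` positive, `J` being the type of `d`, so `x • -(wI • τ)` is
    -- negative, whereas `x` keeps `Φ_I⁺` positive.
    have h7 := smul_posSpan_pos d.rep_smul_pos ⟨neg_mem_posRoots.2 hτn, h6⟩
    rw [smul_neg, smul_inv_smul, neg_mem_posRoots] at h7
    exact not_neg_of_pos (smul_posSpan_pos c.rep_smul_pos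
      (neg_longest_smul_mem hIS (simple_mem_posSpan hτ))) h7
  · rwa [ParabolicCoset.maxRep_ofMaxRep]

/-- Enlarge the type whenever an ascent outside it stays below `d.maxRep`. If none does, then either
the minimal representatives agree and the cosets coincide, or an ascent of `c.rep` towards `d.rep`
lies in the type and a reflection can be dropped. -/
theorem exists_step {c d : R.ParabolicCoset} (hrep : c.rep ≤ d.rep)
    (hmax : c.maxRep ≤ d.maxRep) (hne : c ≠ d) :
    ∃ c', FacialCover c c' ∧ c'.rep ≤ d.rep ∧ c'.maxRep ≤ d.maxRep := by
  by_cases hup : ∃ (α : V) (hα : α ∈ R.Δ), α ∉ R.simples c.type ∧ c.rep • α ∈ R.posRoots ∧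
      c.rep * R.simpleReflection hα ≤ d.maxRep
  · obtain ⟨α, hα, hαI, hpos, hle⟩ := hup
    have hsub : insert (R.simpleReflection hα) c.type ⊆ R.S :=
      Set.insert_subset (simpleReflection_mem hα) c.type_subset
    let c' : R.ParabolicCoset := ⟨c.rep, insert (R.simpleReflection hα) c.type, hsub, by
      rintro s (rfl | hs)
      · exact length_mul_of_pos hα hpos
      · exact c.rep_mem s hs⟩
    refine ⟨c', FacialCover.up c c' _ (simpleReflection_mem hα)
      (fun h => hαI ((mem_simples_iff hα).2 h)) rfl rfl, hrep, c'.isLUB_maxRep.2 ?_⟩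
    rintro t (rfl | ⟨s, rfl | hs, rfl⟩)
    · exact hrep.trans d.rep_le_maxRep
    · exact hle
    · exact (c.isLUB_maxRep.1 (Set.mem_insert_of_mem _ ⟨s, hs, rfl⟩)).trans hmax
  · push Not at hup
    rcases hrep.eq_or_lt with heq | hlt
    · have hsub : d.type ⊆ c.type := by
        refine subset_of_simples_subset d.type_subset fun α hα => ?_
        by_contra hαI
        refine hup α hα.1 hαI (heq ▸ d.rep_smul_pos α hα) ?_
        rw [heq]
        exact d.isLUB_maxRep.1
          (Set.mem_insert_of_mem _ ⟨_, (mem_simples_iff hα.1).1 hα, rfl⟩)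
      exact absurd (ParabolicCoset.ext_rep heq
        (hmax.antisymm (maxRep_le_of_subset heq.symm hsub))) hne
    · obtain ⟨α, hα, hpos, hle⟩ := exists_mul_le_of_lt hlt
      have hαI : α ∈ R.simples c.type := by
        by_contra hαI
        exact hup α hα hαI hpos (hle.trans d.rep_le_maxRep)
      refine exists_down_step hrep hmax hαI (weakOrder_iff.1 hle ?_)
      rw [inversions_mul_of_pos hα hpos]
      exact Set.mem_insert _ _

/-- The facial weak order compares the minimal and the maximal representatives. -/
theorem facial_le_iff {c d : R.ParabolicCoset} :
    c ≤ d ↔ c.rep ≤ d.rep ∧ c.maxRep ≤ d.maxRep := by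
  refine ⟨le_of_facial_le, fun ⟨h1, h2⟩ => ?_⟩
  -- Each step weakly raises both lengths and strictly raises at least one, since the two
  -- representatives determine the coset.
  induction hk : R.length d.rep + R.length d.maxRep - (R.length c.rep + R.length c.maxRep)
    using Nat.strong_induction_on generalizing c with
  | _ k ih =>
    by_cases hne : c = d
    · rw [hne]
    obtain ⟨c', hc, h3, h4⟩ := exists_step h1 h2 hne
    refine Relation.ReflTransGen.head hc (ih _ ?_ ⟨h3, h4⟩ h3 h4 rfl)
    have h5 := length_le_of_le hc.le.1
    have h6 := length_le_of_le hc.le.2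
    have h7 := length_le_of_le h3
    have h8 := length_le_of_le h4
    have h9 : ¬ (R.length c'.rep ≤ R.length c.rep ∧ R.length c'.maxRep ≤ R.length c.maxRep) :=
      fun h => hc.ne (ParabolicCoset.ext_rep (eq_of_le_of_length_le hc.le.1 h.1)
        (eq_of_le_of_length_le hc.le.2 h.2))
    omega

/-! ### Parabolic cosets as faces of the weak order -/

theorem smul_neg_of_mul_le {z : R.W} {α : V} (hα : α ∈ R.Δ)
    (h : z * R.simpleReflection hα ≤ z) : z • α ∈ R.negRoots :=
  (not_pos_iff (smul_mem_roots _ (R.simple_subset hα))).1 fun h' =>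
    (lt_mul_of_pos hα h').not_ge h

theorem smul_pos_of_le_mul {z : R.W} {α : V} (hα : α ∈ R.Δ)
    (h : z ≤ z * R.simpleReflection hα) : z • α ∈ R.posRoots :=
  (not_neg_iff (smul_mem_roots _ (R.simple_subset hα))).1 fun h' =>
    (mul_lt_of_neg hα h').not_ge h

variable (R) in
theorem isLowerFacial :
    IsLowerFacial {p : R.W × R.W | ∃ c : R.ParabolicCoset, (c.rep, c.maxRep) = p} where
  exists_covers := by
    rintro x m ⟨c, hc⟩
    obtain ⟨rfl, rfl⟩ := Prod.ext_iff.1 hc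
    refine ⟨_, ?_, c.isGLB_rep⟩
    rintro _ ⟨s, hs, rfl⟩
    obtain ⟨α, hα, rfl⟩ := exists_eq_simpleReflection (c.type_subset hs)
    exact mul_covBy_of_neg hα (c.maxRep_smul_neg α ((mem_simples_iff hα).2 hs))
  exists_face z K hK := by
    -- Lower covers of `z` are the products `z * s` with `s` a descent, so `K` is recorded by a
    -- type.
    have hS : {s | s ∈ R.S ∧ z * s ∈ K} ⊆ R.S := fun s hs => hs.1
    have hneg : ∀ α ∈ R.simples {s | s ∈ R.S ∧ z * s ∈ K}, z • α ∈ R.negRoots := fun α hα =>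
      smul_neg_of_mul_le hα.1 (hK _ ((mem_simples_iff hα.1).1 hα).2).le
    refine ⟨z * R.longest {s | s ∈ R.S ∧ z * s ∈ K},
      ⟨ParabolicCoset.ofMaxRep z _ hS hneg, ?_⟩, ?_⟩
    · rw [ParabolicCoset.maxRep_ofMaxRep]
      rfl
    · have h := isGLB_mul_longest hS hneg
      have h1 : (z * ·) '' {s | s ∈ R.S ∧ z * s ∈ K} = K := by
        refine Set.Subset.antisymm ?_ fun c hc => ?_
        · rintro _ ⟨s, hs, rfl⟩
          exact hs.2
        · obtain ⟨α, hα, -, rfl⟩ := exists_of_covBy_left (hK c hc)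
          exact ⟨_, ⟨simpleReflection_mem hα, hc⟩, rfl⟩
      rwa [h1] at h

variable (R) in
theorem isLowerFacial_dual :
    IsLowerFacial {p : R.Wᵒᵈ × R.Wᵒᵈ | ∃ c : R.ParabolicCoset,
      (OrderDual.toDual c.maxRep, OrderDual.toDual c.rep) = p} where
  exists_covers := by
    rintro x m ⟨c, hc⟩
    obtain ⟨rfl, rfl⟩ := Prod.ext_iff.1 hc
    refine ⟨(fun s => OrderDual.toDual (c.rep * s)) '' c.type, ?_, c.isLUB_maxRep⟩
    rintro _ ⟨s, hs, rfl⟩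
    obtain ⟨α, hα, rfl⟩ := exists_eq_simpleReflection (c.type_subset hs)
    exact (covBy_mul_of_pos hα (c.rep_smul_pos α ((mem_simples_iff hα).2 hs))).toDual
  exists_face z K hK := by
    let x : R.W := OrderDual.ofDual z
    let I : Set R.W := {s | s ∈ R.S ∧ OrderDual.toDual (x * s) ∈ K}
    have hS : I ⊆ R.S := fun s hs => hs.1
    have hpos : ∀ α ∈ R.simples I, x • α ∈ R.posRoots := fun α hα =>
      smul_pos_of_le_mul hα.1 (hK _ ((mem_simples_iff hα.1).1 hα).2).le
    refine ⟨OrderDual.toDual (x * R.longest I),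
      ⟨⟨x, I, hS, (mem_minReps_iff hS).2 hpos⟩, rfl⟩, ?_⟩
    have h := isLUB_mul_longest hS hpos
    have h1 : (x * ·) '' I = OrderDual.toDual ⁻¹' K := by
      refine Set.Subset.antisymm ?_ fun c hc => ?_
      · rintro _ ⟨s, hs, rfl⟩
        exact hs.2
      · obtain ⟨α, hα, -, h2⟩ := exists_of_covBy_right (R := R) (hK _ hc).ofDual
        have h3 : c = x * R.simpleReflection hα := h2
        subst h3
        exact ⟨_, ⟨simpleReflection_mem hα, hc⟩, rfl⟩
    rw [h1] at h
    exact h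

theorem IsWeakOrderCongruence.inf {r : Setoid R.W} (hr : IsWeakOrderCongruence r)
    {x x' y y' : R.W} (hx : r x x') (hy : r y y') : r (x ⊓ y) (x' ⊓ y') :=
  hr.meet hx hy isGLB_pair isGLB_pair

theorem IsWeakOrderCongruence.sup {r : Setoid R.W} (hr : IsWeakOrderCongruence r)
    {x x' y y' : R.W} (hx : r x x') (hy : r y y') : r (x ⊔ y) (x' ⊔ y') :=
  hr.join hx hy isLUB_pair isLUB_pair

theorem bot_le_of_le {r : Setoid R.W} (hr : IsWeakOrderCongruence r) {a c b : R.ParabolicCoset}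
    (ha : ∀ d, facialCongruence r d a → a ≤ d) (hb : ∀ d, facialCongruence r d b → b ≤ d)
    (hbc : facialCongruence r b c) (h : a ≤ c) : a ≤ b := by
  rw [facial_le_iff] at h ⊢
  refine (isLowerFacial R).le_of_minimal hr.inf hr.sup ⟨a, rfl⟩ ?_ ⟨c, rfl⟩ ⟨b, rfl⟩
    hbc.1 hbc.2 ?_ h.1 h.2
  · rintro p q ⟨d, hd⟩ h1 h2
    obtain ⟨rfl, rfl⟩ := Prod.ext_iff.1 hd
    exact facial_le_iff.1 (ha d ⟨h1, h2⟩)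
  · rintro p q ⟨d, hd⟩ h1 h2
    obtain ⟨rfl, rfl⟩ := Prod.ext_iff.1 hd
    exact facial_le_iff.1 (hb d ⟨h1, h2⟩)

theorem le_top_of_le {r : Setoid R.W} (hr : IsWeakOrderCongruence r) {a c b : R.ParabolicCoset}
    (ha : ∀ d, facialCongruence r d a → d ≤ a) (hb : ∀ d, facialCongruence r d b → d ≤ b)
    (hbc : facialCongruence r b c) (h : c ≤ a) : b ≤ a := by
  rw [facial_le_iff] at h ⊢
  -- In the dual lattice the two representatives exchange roles, as do meets and joins.
  refine (IsLowerFacial.le_of_minimal (L := R.Wᵒᵈ) (r := r) (isLowerFacial_dual R) hr.sup hr.inf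
    ⟨a, rfl⟩ ?_ ⟨c, rfl⟩ ⟨b, rfl⟩ hbc.2 hbc.1 ?_ h.2 h.1).symm
  · rintro p q ⟨d, hd⟩ h1 h2
    obtain ⟨rfl, rfl⟩ := Prod.ext_iff.1 hd
    exact (facial_le_iff.1 (ha d ⟨h2, h1⟩)).symm
  · rintro p q ⟨d, hd⟩ h1 h2
    obtain ⟨rfl, rfl⟩ := Prod.ext_iff.1 hd
    exact (facial_le_iff.1 (hb d ⟨h2, h1⟩)).symm

/-! ### Root inversion sets -/

theorem ParabolicCoset.mem_rootSet_iff {c : R.ParabolicCoset} {β : V} :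
    β ∈ c.rootSet ↔ c.rep⁻¹ • β ∈ R.negRoots ∨ c.rep⁻¹ • β ∈ R.posSpan c.type := by
  rw [rootSet, parabolicRoots_inter c.type_subset]
  constructor
  · rintro ⟨γ, hγ, rfl⟩
    change c.rep⁻¹ • c.rep • γ ∈ _ ∨ c.rep⁻¹ • c.rep • γ ∈ _
    rwa [inv_smul_smul]
  · exact fun h => ⟨c.rep⁻¹ • β, h, smul_inv_smul c.rep β⟩

theorem ParabolicCoset.rootSet_subset (c : R.ParabolicCoset) : c.rootSet ⊆ R.Φ := fun _ hβ =>
  (mem_rootSet_iff.1 hβ).elim (fun h => mem_roots_of_smul h.1) fun h => mem_roots_of_smul h.1.1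

theorem ParabolicCoset.mem_rootSet_of_pos {c : R.ParabolicCoset} {β : V}
    (hβ : β ∈ R.posRoots) : β ∈ c.rootSet ↔ β ∈ R.inversions c.maxRep := by
  rw [mem_rootSet_iff, mem_inversions_maxRep]
  simp only [inversions, Set.mem_ofPred_eq, hβ, true_and]

theorem ParabolicCoset.neg_mem_rootSet {c : R.ParabolicCoset} {β : V}
    (hβ : β ∈ R.posRoots) : -β ∈ c.rootSet ↔ β ∉ R.inversions c.rep := by
  have h1 : c.rep⁻¹ • -β ∉ R.posSpan c.type := fun h => by
    have h2 := smul_posSpan_pos c.rep_smul_pos h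
    rw [smul_inv_smul, neg_mem_posRoots] at h2
    exact not_neg_of_pos hβ h2
  rw [mem_rootSet_iff, or_iff_left h1, smul_neg, neg_mem_negRoots,
    ← not_neg_iff (smul_mem_roots _ hβ.1)]
  simp only [inversions, Set.mem_ofPred_eq, hβ, true_and]

/-- The positive parts grow along the facial order, so the intersection is attained at the bottom;
the negative parts shrink, so theirs is attained at the top. -/
theorem mem_classRootSet_of_pos {a b : R.ParabolicCoset} (hab : a ≤ b) {β : V}
    (hβ : β ∈ R.posRoots) :
    β ∈ classRootSet (Set.Icc a b) ↔ β ∈ R.inversions a.maxRep := by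
  simp only [classRootSet, Set.mem_iInter₂, ParabolicCoset.mem_rootSet_of_pos hβ]
  exact ⟨fun h => h a ⟨le_rfl, hab⟩, fun h c hc =>
    weakOrder_iff.1 (facial_le_iff.1 hc.1).2 h⟩

theorem neg_mem_classRootSet {a b : R.ParabolicCoset} (hab : a ≤ b) {β : V}
    (hβ : β ∈ R.posRoots) :
    -β ∈ classRootSet (Set.Icc a b) ↔ β ∉ R.inversions b.rep := by
  simp only [classRootSet, Set.mem_iInter₂, ParabolicCoset.neg_mem_rootSet hβ]
  exact ⟨fun h => h b ⟨hab, le_rfl⟩, fun h c hc h' =>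
    h (weakOrder_iff.1 (facial_le_iff.1 hc.2).1 h')⟩

theorem classRootSet_subset {a b : R.ParabolicCoset} (hab : a ≤ b) :
    classRootSet (Set.Icc a b) ⊆ R.Φ := fun _ hβ =>
  a.rootSet_subset (Set.mem_iInter₂.1 hβ a ⟨le_rfl, hab⟩)

theorem classRootSet_inter_subset_iff {a b a' b' : R.ParabolicCoset} (hab : a ≤ b)
    (hab' : a' ≤ b') :
    (classRootSet (Set.Icc a b) ∩ R.posRoots ⊆ classRootSet (Set.Icc a' b') ∩ R.posRoots ∧
      classRootSet (Set.Icc a' b') ∩ R.negRoots ⊆ classRootSet (Set.Icc a b) ∩ R.negRoots) ↔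
      a.maxRep ≤ a'.maxRep ∧ b.rep ≤ b'.rep := by
  rw [weakOrder_iff, weakOrder_iff]
  refine and_congr ⟨fun h β hβ => ?_, fun h β hβ => ⟨?_, hβ.2⟩⟩
    ⟨fun h β hβ => ?_, fun h β hβ => ⟨?_, hβ.2⟩⟩
  · exact (mem_classRootSet_of_pos hab' hβ.1).1
      (h ⟨(mem_classRootSet_of_pos hab hβ.1).2 hβ, hβ.1⟩).1
  · exact (mem_classRootSet_of_pos hab' hβ.2).2 (h ((mem_classRootSet_of_pos hab hβ.2).1 hβ.1))
  · by_contra hno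
    exact (neg_mem_classRootSet hab hβ.1).1
      (h ⟨(neg_mem_classRootSet hab' hβ.1).2 hno, neg_mem_negRoots.2 hβ.1⟩).1 hβ
  · have hp := neg_mem_posRoots.2 hβ.2
    have h1 := hβ.1
    rw [← neg_neg β, neg_mem_classRootSet hab' hp] at h1
    rw [← neg_neg β, neg_mem_classRootSet hab hp]
    exact fun h2 => h1 (h h2)

theorem sdiff_subset_iff_inter_subset {X Y : Set V} (hX : X ⊆ R.Φ) (hY : Y ⊆ R.Φ) :
    (X \ Y ⊆ R.negRoots ∧ Y \ X ⊆ R.posRoots) ↔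
      (X ∩ R.posRoots ⊆ Y ∩ R.posRoots ∧ Y ∩ R.negRoots ⊆ X ∩ R.negRoots) := by
  refine and_congr ⟨fun h β hβ => ⟨?_, hβ.2⟩, fun h β hβ => ?_⟩
    ⟨fun h β hβ => ⟨?_, hβ.2⟩, fun h β hβ => ?_⟩
  · by_contra hno
    exact not_neg_of_pos hβ.2 (h ⟨hβ.1, hno⟩)
  · exact (pos_or_neg (hX hβ.1)).resolve_left fun hp => hβ.2 (h ⟨hβ.1, hp⟩).1
  · by_contra hno
    exact not_neg_of_pos (h ⟨hβ.1, hno⟩) hβ.2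
  · exact (pos_or_neg (hY hβ.1)).resolve_right fun hn => hβ.2 (h ⟨hβ.1, hn⟩).1

theorem extremes_of_mem_classes {r : Setoid R.W} {Γ : Set R.ParabolicCoset}
    (hΓ : Γ ∈ (facialCongruence r).classes) {a b : R.ParabolicCoset} (hab : Γ = Set.Icc a b) :
    a ≤ b ∧ facialCongruence r a b ∧ (∀ d, facialCongruence r d a → a ≤ d) ∧
      ∀ d, facialCongruence r d b → d ≤ b := by
  obtain ⟨c, rfl⟩ := hΓ
  have hc : c ∈ Set.Icc a b := hab ▸ (facialCongruence r).refl c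
  have hle : a ≤ b := hc.1.trans hc.2
  have ha : a ∈ {d | facialCongruence r d c} := hab ▸ ⟨le_rfl, hle⟩
  have hb : b ∈ {d | facialCongruence r d c} := hab ▸ ⟨hle, le_rfl⟩
  have hmem : ∀ d, facialCongruence r d c → d ∈ Set.Icc a b := fun d hd => hab ▸ hd
  exact ⟨hle, (facialCongruence r).trans ha ((facialCongruence r).symm hb),
    fun d hd => (hmem d ((facialCongruence r).trans hd ha)).1,
    fun d hd => (hmem d ((facialCongruence r).trans hd hb)).2⟩

end ReflectionSystem
end

/-! ### The equivalence of the seven assertions -/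

open ReflectionSystem in
theorem theorem4p13 {V : Type*} [NormedAddCommGroup V] [InnerProductSpace ℝ V]
    [FiniteDimensional ℝ V] (R : ReflectionSystem V)
    (r : Setoid R.W) (hr : IsWeakOrderCongruence r)
    (Γ Γ' : Set R.ParabolicCoset)
    (hΓ : Γ ∈ (facialCongruence r).classes) (hΓ' : Γ' ∈ (facialCongruence r).classes)
    (a b a' b' : R.ParabolicCoset) (hab : Γ = Set.Icc a b) (hab' : Γ' = Set.Icc a' b') :
    List.TFAE [
      QuotientLE Γ Γ',
      a ≤ a',
      b ≤ b',
      a ≤ b',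
      a.rep ≤ b'.rep ∧ a.maxRep ≤ b'.maxRep,
      classRootSet Γ \ classRootSet Γ' ⊆ R.negRoots ∧
        classRootSet Γ' \ classRootSet Γ ⊆ R.posRoots,
      classRootSet Γ ∩ R.posRoots ⊆ classRootSet Γ' ∩ R.posRoots ∧
        classRootSet Γ' ∩ R.negRoots ⊆ classRootSet Γ ∩ R.negRoots] := by
  obtain ⟨hle, hrab, hmin, hmax⟩ := extremes_of_mem_classes hΓ hab
  obtain ⟨hle', hrab', hmin', hmax'⟩ := extremes_of_mem_classes hΓ' hab'
  subst hab hab'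
  tfae_have 1 → 4 := fun ⟨c, hc, c', hc', h⟩ => (hc.1.trans h).trans hc'.2
  tfae_have 4 → 1 := fun h => ⟨a, ⟨le_rfl, hle⟩, b', ⟨hle', le_rfl⟩, h⟩
  tfae_have 4 ↔ 5 := facial_le_iff
  tfae_have 2 → 4 := fun h => h.trans hle'
  tfae_have 3 → 4 := fun h => hle.trans h
  tfae_have 4 → 2 := bot_le_of_le hr hmin hmin' hrab'
  tfae_have 4 → 3 := le_top_of_le hr hmax' hmax ((facialCongruence r).symm hrab)
  tfae_have 6 ↔ 7 :=
    sdiff_subset_iff_inter_subset (classRootSet_subset hle) (classRootSet_subset hle')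
  tfae_have 4 → 7 := fun h => (classRootSet_inter_subset_iff hle hle').2
    ⟨(facial_le_iff.1 (tfae_4_to_2 h)).2, (facial_le_iff.1 (tfae_4_to_3 h)).1⟩
  -- The comparisons chain as `a.rep ≤ b.rep ≤ b'.rep` and `a.maxRep ≤ a'.maxRep ≤ b'.maxRep`.
  tfae_have 7 → 5 := fun h =>
    have h' := (classRootSet_inter_subset_iff hle hle').1 h
    ⟨(facial_le_iff.1 hle).1.trans h'.2, h'.1.trans (facial_le_iff.1 hle').2⟩
  tfae_finish
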